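/- Work in the language $L_2$ of second-order arithmetic. $\mathrm{RCA}_0$ is the theory with the basic axioms of arithmetic for $0,1,+,\cdot,<$, the induction scheme for $\Sigma^0_1$ formulas and the comprehension scheme for $\Delta^0_1$ formulas (with parameters). Elements of $2^{\omega}$ are identified with sets of natural numbers, finite strings $\sigma\in 2^{<\omega}$ are coded by natural numbers, and $N_\sigma=\{X\in 2^\omega : X\supseteq\sigma\}$. A pruned tree is a set $T\subseteq 2^{<\omega}$, closed under initial segments, such that for each $\sigma\in T$ at least one of $\sigma^\frown 0,\sigma^\frown 1$ is in $T$; it represents the pruned closed set $[T]=\{X : \forall n\; X\upharpoonright_n\in T\}$. A separably closed set is either empty or the set $\bar S=\{X : \forall k\,\exists n\,\forall i<k\; X_n(i)=X(i)\}$ represented by a sequence $S=\langle X_n\rangle_{n\in\omega}$ of elements of $2^\omega$. A sequence $\{U_n\}_{n\in\omega}$ of nonempty open sets is given by a sequence of nonempty codes $V_n\subseteq 2^{<\omega}$, where $X\in U_n$ if and only if some $\sigma\in V_n$ is an initial segment of $X$. A class $A\subseteq 2^\omega$ is dense in $F\subseteq 2^\omega$ if for every $\sigma\in 2^{<\omega}$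 with $N_\sigma\cap F\ne\emptyset$ there is $X\in N_\sigma\cap F\cap A$. Then each of the following two statements, formalized as a sentence of $L_2$, is provable in $\mathrm{RCA}_0$: (BCTCII) Let $F\subseteq 2^\omega$ be a separably closed set and let $\{U_n\}_{n\in\omega}$ be a sequence of nonempty open sets in $2^\omega$, each of which is dense in $F$. Then $\bigcap_{n\in\omega}U_n$ is dense in $F$. (BCTCIII) Let $F\subseteq 2^\omega$ be a pruned closed set and let $\{U_n\}_{n\in\omega}$ be a sequence of nonempty open sets in $2^\omega$, each of which is dense in $F$. Then $\bigcap_{n\in\omega}U_n$ is dense in $F$. -/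

import Mathlib

/-! Two-sorted language of second-order arithmetic, a Hilbert calculus for it, the theory `RCA₀`,
and the sentences expressing two forms of the Baire Category Theorem for closed sets. -/

namespace SOA

/-! ### Terms and formulas

Number variables and set variables are two separate families of de Bruijn indices. -/

/-- Numerical terms. -/
inductive NTerm : Type
  | var : ℕ → NTerm
  | zero : NTerm
  | one : NTerm
  | add : NTerm → NTerm → NTerm
  | mul : NTerm → NTerm → NTerm

/-- Formulas of second-order arithmetic: `s = t`, `s < t`, `t ∈ X`, falsum, implication,
and universal quantification over numbers and over sets. Set equality is not primitive. -/
inductive Fml : Type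
  | eq : NTerm → NTerm → Fml
  | lt : NTerm → NTerm → Fml
  | mem : NTerm → ℕ → Fml
  | falsum : Fml
  | imp : Fml → Fml → Fml
  | allN : Fml → Fml
  | allS : Fml → Fml

namespace NTerm

/-- Simultaneous substitution of terms for number variables. -/
def subst (f : ℕ → NTerm) : NTerm → NTerm
  | var n => f n
  | zero => zero
  | one => one
  | add s t => add (s.subst f) (t.subst f)
  | mul s t => mul (s.subst f) (t.subst f)

/-- Weakening past one number quantifier. -/
def up (t : NTerm) : NTerm := t.subst fun n => var (n + 1)

/-- The pairing term `(x, y) = (x + y)² + x`. -/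
def pair (x y : NTerm) : NTerm := add (mul (add x y) (add x y)) x

end NTerm

open NTerm

/-- A number substitution, moved under a number quantifier. -/
def liftN (f : ℕ → NTerm) : ℕ → NTerm
  | 0 => var 0
  | n + 1 => (f n).up

/-- A renaming of set variables, moved under a set quantifier. -/
def liftS (r : ℕ → ℕ) : ℕ → ℕ
  | 0 => 0
  | n + 1 => r n + 1

namespace Fml

/-- Simultaneous capture-avoiding substitution for number variables and renaming of
set variables. -/
def subst : (ℕ → NTerm) → (ℕ → ℕ) → Fml → Fml
  | f, _, eq s t => eq (s.subst f) (t.subst f)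
  | f, _, lt s t => lt (s.subst f) (t.subst f)
  | f, r, mem t X => mem (t.subst f) (r X)
  | _, _, falsum => falsum
  | f, r, imp a b => imp (subst f r a) (subst f r b)
  | f, r, allN a => allN (subst (liftN f) r a)
  | f, r, allS a => allS (subst f (liftS r) a)

/-- Weakening past one number quantifier. -/
def upN (a : Fml) : Fml := a.subst (fun n => var (n + 1)) id

/-- Weakening past one set quantifier. -/
def upS (a : Fml) : Fml := a.subst var fun n => n + 1

/-- `a(t)`: number variable `0` is replaced by `t`, the others are lowered by one. -/
def instN (a : Fml) (t : NTerm) : Fml :=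
  a.subst (fun n => match n with | 0 => t | k + 1 => var k) id

/-- `a(Y)`: set variable `0` is replaced by the set variable `Y`, the others are lowered. -/
def instS (a : Fml) (Y : ℕ) : Fml :=
  a.subst var fun n => match n with | 0 => Y | k + 1 => k

/-- `a(x + 1)`, where `x` is number variable `0`. -/
def succN (a : Fml) : Fml :=
  a.subst (fun n => match n with | 0 => add (var 0) one | k + 1 => var (k + 1)) id

def neg (a : Fml) : Fml := imp a falsum
def and (a b : Fml) : Fml := neg (imp a (neg b))
def or (a b : Fml) : Fml := imp (neg a) b
def iff (a b : Fml) : Fml := and (imp a b) (imp b a)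
def exN (a : Fml) : Fml := neg (allN (neg a))
def exS (a : Fml) : Fml := neg (allS (neg a))

/-- `∀ x < t, a`; the term `t` lives outside the quantifier. -/
def ballN (t : NTerm) (a : Fml) : Fml := allN (imp (lt (var 0) t.up) a)

/-- `∃ x < t, a`; the term `t` lives outside the quantifier. -/
def bexN (t : NTerm) (a : Fml) : Fml := exN (and (lt (var 0) t.up) a)

end Fml

open Fml

infixr:25 " ➝ " => SOA.Fml.imp
infixl:30 " ⋎ " => SOA.Fml.or
infixr:35 " ⋏ " => SOA.Fml.and
infix:20 " ⭤ " => SOA.Fml.iff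

/-! ### Derivability -/

/-- Derivability from the formulas in `T` in a Hilbert calculus for classical two-sorted
first-order logic with equality between numbers. The rules of generalization bind variable `0`
and lower the other variables, so that free variables of the members of `T` are read universally. -/
inductive Provable (T : Set Fml) : Fml → Prop
  | ax {a : Fml} : a ∈ T → Provable T a
  | mp {a b : Fml} : Provable T (a ➝ b) → Provable T a → Provable T b
  | genN {a : Fml} : Provable T a → Provable T (allN a)
  | genS {a : Fml} : Provable T a → Provable T (allS a)
  | k (a b : Fml) : Provable T (a ➝ b ➝ a)
  | s (a b c : Fml) : Provable T ((a ➝ b ➝ c) ➝ (a ➝ b) ➝ a ➝ c)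
  | dne (a : Fml) : Provable T (neg (neg a) ➝ a)
  | specN (a : Fml) (t : NTerm) : Provable T (allN a ➝ a.instN t)
  | distN (a b : Fml) : Provable T (allN (a ➝ b) ➝ allN a ➝ allN b)
  | vacN (a : Fml) : Provable T (a ➝ allN a.upN)
  | specS (a : Fml) (Y : ℕ) : Provable T (allS a ➝ a.instS Y)
  | distS (a b : Fml) : Provable T (allS (a ➝ b) ➝ allS a ➝ allS b)
  | vacS (a : Fml) : Provable T (a ➝ allS a.upS)
  | eqRefl (t : NTerm) : Provable T (eq t t)
  | eqSubst (a : Fml) (t u : NTerm) : Provable T (eq t u ➝ a.instN t ➝ a.instN u)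

/-! ### The theory -/

/-- `Σ⁰₀` formulas: no set quantifiers, and all number quantifiers bounded. -/
inductive IsBounded : Fml → Prop
  | eq (s t : NTerm) : IsBounded (eq s t)
  | lt (s t : NTerm) : IsBounded (lt s t)
  | mem (t : NTerm) (X : ℕ) : IsBounded (mem t X)
  | falsum : IsBounded falsum
  | imp {a b : Fml} : IsBounded a → IsBounded b → IsBounded (a ➝ b)
  | ball (t : NTerm) {a : Fml} : IsBounded a → IsBounded (ballN t a)
  | bex (t : NTerm) {a : Fml} : IsBounded a → IsBounded (bexN t a)

def IsSigma01 (a : Fml) : Prop := ∃ b, IsBounded b ∧ a = exN b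

def IsPi01 (a : Fml) : Prop := ∃ b, IsBounded b ∧ a = allN b

/-- The axioms of `RCA₀` (free variables are parameters, read universally): the basic axioms,
`Σ⁰₁` induction and `Δ⁰₁` comprehension. -/
inductive IsAxiomRCA0 : Fml → Prop
  | succ_ne_zero : IsAxiomRCA0 (neg (eq (add (var 0) one) zero))
  | succ_inj : IsAxiomRCA0
      (eq (add (var 0) one) (add (var 1) one) ➝ eq (var 0) (var 1))
  | add_zero : IsAxiomRCA0 (eq (add (var 0) zero) (var 0))
  | add_succ : IsAxiomRCA0
      (eq (add (var 0) (add (var 1) one)) (add (add (var 0) (var 1)) one))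
  | mul_zero : IsAxiomRCA0 (eq (mul (var 0) zero) zero)
  | mul_succ : IsAxiomRCA0
      (eq (mul (var 0) (add (var 1) one)) (add (mul (var 0) (var 1)) (var 0)))
  | not_lt_zero : IsAxiomRCA0 (neg (lt (var 0) zero))
  | lt_succ : IsAxiomRCA0
      (lt (var 0) (add (var 1) one) ⭤ (lt (var 0) (var 1) ⋎ eq (var 0) (var 1)))
  | induction (a : Fml) : IsSigma01 a →
      IsAxiomRCA0 ((a.instN zero ⋏ allN (a ➝ a.succN)) ➝ allN a)
  | comprehension (a b : Fml) : IsSigma01 a → IsPi01 b →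
      IsAxiomRCA0 (allN (a ⭤ b) ➝ exS (allN (mem (var 0) 0 ⭤ a.upS)))

def RCA0 : Set Fml := {a | IsAxiomRCA0 a}

/-! ### Cantor space in the language

An element of `2^ω` is a set `X`, read as `X(i) = 1` iff `i ∈ X`. A binary string of length `l`
is coded by a number `(l, (m, n))`, read as: bit `i < l` is `1` iff `m(i + 1) + 1` divides `n`;
among the numbers that code a given string the least one is taken.
Number arguments of the following formulas are terms, set arguments are variables. -/

/-- `a` divides `b`. -/
def fDvd (a b : NTerm) : Fml := bexN (add b one) (eq b.up (mul (var 0) a.up))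

/-- `s` has the form `(l, (m, n))`. -/
def fLen (s l : NTerm) : Fml :=
  exN (exN (eq s.up.up (pair l.up.up (pair (var 1) (var 0)))))

/-- `s = (l, (m, n))` for some `l, m, n` with `i < l` and `m(i + 1) + 1 ∣ n`. -/
def fBit (s i : NTerm) : Fml :=
  exN (exN (exN
    (eq s.up.up.up (pair (var 2) (pair (var 1) (var 0))) ⋏
      lt i.up.up.up (var 2) ⋏
      fDvd (add (mul (var 1) (add i.up.up.up one)) one) (var 0))))

/-- `s` and `t` have the same length and the same bits. -/
def fSame (s t : NTerm) : Fml :=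
  exN (fLen s.up (var 0) ⋏ fLen t.up (var 0) ⋏
    ballN (var 0) (fBit s.up.up (var 0) ⭤ fBit t.up.up (var 0)))

/-- `s ∈ 2^{<ω}`: `s` is the least code of a binary string. -/
def fStr (s : NTerm) : Fml := exN (fLen s.up (var 0)) ⋏ ballN s (neg (fSame (var 0) s.up))

/-- `s ⊆ t` for strings `s` and `t`. -/
def fPrefix (s t : NTerm) : Fml :=
  fStr s ⋏ fStr t ⋏
    exN (exN (fLen s.up.up (var 1) ⋏ fLen t.up.up (var 0) ⋏ lt (var 1) (add (var 0) one) ⋏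
      ballN (var 1) (fBit s.up.up.up (var 0) ⭤ fBit t.up.up.up (var 0))))

/-- `t = s⌢0`. -/
def fAppend0 (s t : NTerm) : Fml :=
  fPrefix s t ⋏
    exN (fLen s.up (var 0) ⋏ fLen t.up (add (var 0) one) ⋏ neg (fBit t.up (var 0)))

/-- `t = s⌢1`. -/
def fAppend1 (s t : NTerm) : Fml :=
  fPrefix s t ⋏
    exN (fLen s.up (var 0) ⋏ fLen t.up (add (var 0) one) ⋏ fBit t.up (var 0))

/-- `X` extends the string `s`, that is `X ∈ N_s`. -/
def fCyl (s : NTerm) (X : ℕ) : Fml :=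
  fStr s ⋏ exN (fLen s.up (var 0) ⋏ ballN (var 0) (fBit s.up.up (var 0) ⭤ mem (var 0) X))

/-- `T` is a tree: a set of strings closed under initial segments. -/
def fTree (T : ℕ) : Fml :=
  allN (mem (var 0) T ➝ fStr (var 0)) ⋏
    allN (mem (var 0) T ➝ allN (fPrefix (var 0) (var 1) ➝ mem (var 0) T))

/-- `T` is a pruned tree. -/
def fPruned (T : ℕ) : Fml :=
  fTree T ⋏ allN (mem (var 0) T ➝
    (exN (fAppend0 (var 1) (var 0) ⋏ mem (var 0) T) ⋎
      exN (fAppend1 (var 1) (var 0) ⋏ mem (var 0) T)))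

/-- `X ∈ [T]`: for every `n` the initial segment of `X` of length `n` lies in `T`. -/
def fPath (X T : ℕ) : Fml :=
  allN (exN (fCyl (var 0) X ⋏ fLen (var 0) (var 1) ⋏ mem (var 0) T))

/-- `X` lies in the separably closed set with code `(e, S)`. The code with `e = 0` stands for the
empty set. For `e ≠ 0` it stands for the closure of the sequence `S_n = {i | (n, i) ∈ S}`:
for all `k` there is `n` such that `S_n(i) = X(i)` for all `i < k`. -/
def fSepMem (e : NTerm) (S X : ℕ) : Fml :=
  neg (eq e zero) ⋏
    allN (exN (ballN (var 1) (mem (pair (var 1) (var 0)) S ⭤ mem (var 0) X)))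

/-- `V` codes a sequence of nonempty open sets: each `V_n = {s | (n, s) ∈ V}` is a nonempty
set of strings. -/
def fOpenSeq (V : ℕ) : Fml :=
  allN (allN (mem (pair (var 1) (var 0)) V ➝ fStr (var 0)) ⋏
    exN (mem (pair (var 1) (var 0)) V))

/-- `X` lies in the open set `U_n` with code `V_n`: some `s ∈ V_n` is an initial segment of `X`. -/
def fOpenMem (n : NTerm) (V X : ℕ) : Fml :=
  exN (mem (pair n.up (var 0)) V ⋏ fCyl (var 0) X)

/-- The class `{X | A}` is dense in the class `{X | F}`: every `N_s` that meets `F` meets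
`F ∩ A`. Here `F` and `A` are written below the quantifiers: in them `X` is set variable `0`,
`s` is number variable `0`, and outer variables are raised by one. -/
def fDense (F A : Fml) : Fml :=
  allN (fStr (var 0) ➝ exS (fCyl (var 0) 0 ⋏ F) ➝ exS (fCyl (var 0) 0 ⋏ F ⋏ A))

/-- Baire Category Theorem for separably closed sets: for all `e`, `S`, `V`, if `V` codes a
sequence of nonempty open sets `U_n` each of which is dense in the separably closed set coded by
`(e, S)`, then so is the intersection of the `U_n`. -/
def BCTCII : Fml :=
  allN (allS (allS
    (fOpenSeq 0 ➝
      allN (fDense (fSepMem (var 2) 2 0) (fOpenMem (var 1) 1 0)) ➝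
      fDense (fSepMem (var 1) 2 0) (allN (fOpenMem (var 0) 1 0)))))

/-- Baire Category Theorem for pruned closed sets: for all `T`, `V`, if `T` is a pruned tree and
`V` codes a sequence of nonempty open sets `U_n` each of which is dense in `[T]`, then so is the
intersection of the `U_n`. -/
def BCTCIII : Fml :=
  allS (allS
    (fPruned 1 ➝ fOpenSeq 0 ➝
      allN (fDense (fPath 0 2) (fOpenMem (var 1) 1 0)) ➝
      fDense (fPath 0 2) (allN (fOpenMem (var 0) 1 0))))

end SOA

/-!
Both sentences are derived through Gödel's completeness theorem: `SOA.provable_of_forall_sat` says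
that a formula holding in every two-sorted structure that satisfies `RCA₀` is derivable. It is
proved by a Henkin construction. The free variables of the language are countably many and serve as
witnesses, so no constants have to be added; the numbers of the term model are the terms modulo
provable equality, and its sets are the set variables. The renaming of a fresh variable needs a
theory whose substitution instances are derivable, which `RCA₀` is (`SOA.substClosed_RCA0`).

What remains is mathematics inside an arbitrary, possibly nonstandard, model `M` of `RCA₀`.
Comprehension and induction become statements about the predicates on `M` that are bounded
definable with parameters (`SOA.D0`, `SOA.sigma_induction`, `SOA.delta_comprehension`). Induction
makes `M` a discretely ordered semiring. As in Gödel's `β`-lemma, pairwise coprime moduli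
`m(i + 1) + 1` give a code for every initial segment of every set of the model
(`SOA.RCAModel.exists_beta`). These codes also represent finite sets, and so the histories of a
recursion. Always choosing the least possible next value, one gets dependent choice for bounded
relations as a `Δ⁰₁` definable sequence (`SOA.RCAModel.exists_sequence`), and from it the union of
an increasing sequence of strings (`SOA.RCAModel.exists_limit`).

The Baire Category Theorem follows from `exists_limit`. A string that meets the closed set is
extended, at stage `k`, to a longer one that extends a string in the code of the `k`-th open set and
still meets the closed set. For a pruned tree the second condition is membership in the tree; for
the closure of a sequence it is being an initial segment of a term of the sequence, whose index is
chosen along with the string. Both are bounded, given the index, so the choices can be made in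
`RCA₀`.
-/

namespace SOA

/-! ### Substitution -/

namespace NTerm

theorem subst_subst (t : NTerm) (f g : ℕ → NTerm) :
    (t.subst f).subst g = t.subst fun n => (f n).subst g := by
  induction t <;> simp_all [subst]

theorem subst_var (t : NTerm) : t.subst var = t := by
  induction t <;> simp_all [subst]

/-- A strict bound on the indices of the variables of a term. -/
def bound : NTerm → ℕ
  | var n => n + 1
  | zero => 0
  | one => 0
  | add s t => max s.bound t.bound
  | mul s t => max s.bound t.bound

theorem subst_congr (t : NTerm) {f g : ℕ → NTerm} (h : ∀ n < t.bound, f n = g n) :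
    t.subst f = t.subst g := by
  induction t with
  | var n => exact h n (Nat.lt_succ_self n)
  | zero => rfl
  | one => rfl
  | add s t hs ht | mul s t hs ht =>
    simp only [subst]
    rw [hs fun n hn => h n (lt_of_lt_of_le hn (le_max_left _ _)),
      ht fun n hn => h n (lt_of_lt_of_le hn (le_max_right _ _))]

theorem up_subst_liftN (t : NTerm) (f : ℕ → NTerm) :
    t.up.subst (liftN f) = (t.subst f).up := by
  simp only [up, subst_subst]
  rfl

end NTerm

/-- The sequence `x, e 0, e 1, …`. -/
def scons {α : Type*} (x : α) (e : ℕ → α) : ℕ → α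
  | 0 => x
  | n + 1 => e n

theorem scons_zero {α : Type*} (x : α) (e : ℕ → α) : scons x e 0 = x := rfl

theorem scons_succ {α : Type*} (x : α) (e : ℕ → α) (n : ℕ) : scons x e (n + 1) = e n := rfl

theorem comp_scons {α β : Type*} (h : α → β) (x : α) (e : ℕ → α) :
    (fun n => h (scons x e n)) = scons (h x) fun n => h (e n) := by
  funext n; cases n <;> rfl

namespace Fml

theorem subst_subst (a : Fml) (f g : ℕ → NTerm) (r q : ℕ → ℕ) :
    (a.subst f r).subst g q = a.subst (fun n => (f n).subst g) fun n => q (r n) := by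
  induction a generalizing f g r q with
  | eq s t | lt s t => simp only [subst, NTerm.subst_subst]
  | mem t X => simp only [subst, NTerm.subst_subst]
  | falsum => rfl
  | imp a b ha hb => simp only [subst, ha, hb]
  | allN a ha =>
    simp only [subst, ha]
    congr 2
    funext n
    cases n with
    | zero => rfl
    | succ n => exact NTerm.up_subst_liftN _ _
  | allS a ha =>
    simp only [subst, ha]
    congr 2
    funext n
    cases n <;> rfl

/-- A strict bound on the indices of the free number variables of a formula. -/
def boundN : Fml → ℕ
  | eq s t => max s.bound t.bound
  | lt s t => max s.bound t.bound
  | mem t _ => t.bound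
  | falsum => 0
  | imp a b => max a.boundN b.boundN
  | allN a => a.boundN - 1
  | allS a => a.boundN

/-- A strict bound on the indices of the free set variables of a formula. -/
def boundS : Fml → ℕ
  | eq _ _ => 0
  | lt _ _ => 0
  | mem _ X => X + 1
  | falsum => 0
  | imp a b => max a.boundS b.boundS
  | allN a => a.boundS
  | allS a => a.boundS - 1

theorem subst_congr (a : Fml) {f g : ℕ → NTerm} {r q : ℕ → ℕ}
    (h : ∀ n < a.boundN, f n = g n) (h' : ∀ n < a.boundS, r n = q n) :
    a.subst f r = a.subst g q := by
  induction a generalizing f g r q with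
  | eq s t | lt s t =>
    simp only [subst]
    rw [s.subst_congr fun n hn => h n (lt_of_lt_of_le hn (le_max_left _ _)),
      t.subst_congr fun n hn => h n (lt_of_lt_of_le hn (le_max_right _ _))]
  | mem t X => simp only [subst, t.subst_congr h, h' X (Nat.lt_succ_self X)]
  | falsum => rfl
  | imp a b ha hb =>
    simp only [subst]
    rw [ha (fun n hn => h n (lt_of_lt_of_le hn (le_max_left _ _)))
        fun n hn => h' n (lt_of_lt_of_le hn (le_max_left _ _)),
      hb (fun n hn => h n (lt_of_lt_of_le hn (le_max_right _ _)))
        fun n hn => h' n (lt_of_lt_of_le hn (le_max_right _ _))]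
  | allN a ha =>
    simp only [subst]
    rw [ha (fun n hn => ?_) h']
    cases n with
    | zero => rfl
    | succ n => simp only [liftN, h n (by simp only [boundN]; omega)]
  | allS a ha =>
    simp only [subst]
    rw [ha h fun n hn => ?_]
    cases n with
    | zero => rfl
    | succ n => simp only [liftS, h' n (by simp only [boundS]; omega)]

theorem subst_var (a : Fml) : a.subst NTerm.var id = a := by
  induction a with
  | eq s t | lt s t => simp only [subst, NTerm.subst_var]
  | mem t X => simp only [subst, NTerm.subst_var, id]
  | falsum => rfl
  | imp a b ha hb => simp only [subst, ha, hb]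
  | allN a ha =>
    have : liftN NTerm.var = NTerm.var := by funext n; cases n <;> rfl
    simp only [subst, this, ha]
  | allS a ha =>
    have : liftS id = id := by funext n; cases n <;> rfl
    simp only [subst, this, ha]

theorem instN_eq (a : Fml) (t : NTerm) : a.instN t = a.subst (scons t NTerm.var) id := by
  unfold instN
  congr 1

theorem instS_eq (a : Fml) (Y : ℕ) : a.instS Y = a.subst NTerm.var (scons Y id) := by
  unfold instS
  congr 1

theorem subst_liftN_instN (a : Fml) (f : ℕ → NTerm) (r : ℕ → ℕ) (t : NTerm) :
    (a.subst (liftN f) r).instN t = a.subst (scons t f) r := by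
  rw [instN_eq, subst_subst]
  congr 1
  funext n
  cases n with
  | zero => rfl
  | succ n =>
    simp only [liftN, NTerm.up, NTerm.subst_subst]
    exact NTerm.subst_var _

theorem subst_liftS_instS (a : Fml) (f : ℕ → NTerm) (r : ℕ → ℕ) (Y : ℕ) :
    (a.subst f (liftS r)).instS Y = a.subst f (scons Y r) := by
  rw [instS_eq, subst_subst]
  congr 1
  · funext n; exact NTerm.subst_var _
  · funext n; cases n <;> rfl

theorem instN_subst (a : Fml) (f : ℕ → NTerm) (r : ℕ → ℕ) (t : NTerm) :
    (a.instN t).subst f r = (a.subst (liftN f) r).instN (t.subst f) := by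
  rw [subst_liftN_instN, instN_eq, subst_subst]
  congr 1
  funext n; cases n <;> rfl

theorem instS_subst (a : Fml) (f : ℕ → NTerm) (r : ℕ → ℕ) (Y : ℕ) :
    (a.instS Y).subst f r = (a.subst f (liftS r)).instS (r Y) := by
  rw [subst_liftS_instS, instS_eq, subst_subst]
  congr 1
  funext n; cases n <;> rfl

theorem upN_subst (a : Fml) (f : ℕ → NTerm) (r : ℕ → ℕ) :
    a.upN.subst (liftN f) r = (a.subst f r).upN := by
  simp only [upN, subst_subst]
  rfl

theorem upS_subst (a : Fml) (f : ℕ → NTerm) (r : ℕ → ℕ) :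
    a.upS.subst f (liftS r) = (a.subst f r).upS := by
  simp only [upS, subst_subst]
  congr 1
  funext n
  exact (NTerm.subst_var _).symm

theorem succN_subst (a : Fml) (f : ℕ → NTerm) (r : ℕ → ℕ) :
    a.succN.subst (liftN f) r = (a.subst (liftN f) r).succN := by
  simp only [succN, subst_subst]
  congr 1
  funext n
  cases n with
  | zero => rfl
  | succ n =>
    simp only [liftN, NTerm.subst, NTerm.up, NTerm.subst_subst]

end Fml

/-! ### Derivability from a theory closed under substitution -/

/-- Substitution instances of the members of `T` are derivable from `T`. -/
def SubstClosed (T : Set Fml) : Prop := ∀ a ∈ T, ∀ f r, Provable T (a.subst f r)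

/-- Derivability is closed under substitution, by induction on derivations. -/
theorem Provable.subst {T : Set Fml} (hT : SubstClosed T) {a : Fml} (h : Provable T a) :
    ∀ f r, Provable T (a.subst f r) := by
  induction h with
  | ax h => exact hT _ h
  | mp _ _ h₁ h₂ => exact fun f r => (h₁ f r).mp (h₂ f r)
  | genN _ h => exact fun f r => (h (liftN f) r).genN
  | genS _ h => exact fun f r => (h f (liftS r)).genS
  | k a b => exact fun f r => .k _ _
  | s a b c => exact fun f r => .s _ _ _
  | dne a => exact fun f r => .dne _
  | specN a t =>
    intro f r
    simp only [Fml.subst, Fml.instN_subst]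
    exact .specN _ _
  | distN a b => exact fun f r => .distN _ _
  | vacN a =>
    intro f r
    simp only [Fml.subst, Fml.upN_subst]
    exact .vacN _
  | specS a Y =>
    intro f r
    simp only [Fml.subst, Fml.instS_subst]
    exact .specS _ _
  | distS a b => exact fun f r => .distS _ _
  | vacS a =>
    intro f r
    simp only [Fml.subst, Fml.upS_subst]
    exact .vacS _
  | eqRefl t => exact fun f r => .eqRefl _
  | eqSubst a t u =>
    intro f r
    simp only [Fml.subst, Fml.instN_subst]
    exact .eqSubst _ _ _

/-- Derivability of `a` from `T` and a list of hypotheses whose free variables are held fixed. -/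
def Pr (T : Set Fml) : List Fml → Fml → Prop
  | [], a => Provable T a
  | x :: l, a => Pr T l (x ➝ a)

namespace Pr

variable {T : Set Fml}

theorem of_provable {a : Fml} (h : Provable T a) (l : List Fml) : Pr T l a := by
  induction l generalizing a with
  | nil => exact h
  | cons x l ih => exact ih ((Provable.k _ _).mp h)

theorem mp {l : List Fml} {a b : Fml} (h : Pr T l (a ➝ b)) (h' : Pr T l a) : Pr T l b := by
  induction l generalizing a b with
  | nil => exact Provable.mp h h'
  | cons x l ih => exact ih (ih (of_provable (.s _ _ _) l) h) h'

theorem weaken {l : List Fml} {a : Fml} (x : Fml) (h : Pr T l a) : Pr T (x :: l) a :=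
  mp (l := l) (of_provable (.k a x) l) h

theorem append {l : List Fml} {a : Fml} (l' : List Fml) (h : Pr T l a) : Pr T (l' ++ l) a := by
  induction l' with
  | nil => exact h
  | cons x l' ih => exact ih.weaken x

theorem head (x : Fml) (l : List Fml) : Pr T (x :: l) x :=
  of_provable (((Provable.s x (x ➝ x) x).mp (.k _ _)).mp (.k _ _)) l

theorem by_contra {l : List Fml} {a : Fml} (h : Pr T (a.neg :: l) .falsum) : Pr T l a :=
  mp (of_provable (.dne _) l) h

theorem exfalso {l : List Fml} {a : Fml} (h : Pr T l .falsum) : Pr T l a :=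
  by_contra (h.weaken _)

theorem subst (hT : SubstClosed T) {l : List Fml} {a : Fml} (h : Pr T l a) (f : ℕ → NTerm)
    (r : ℕ → ℕ) : Pr T (l.map (Fml.subst f r)) (a.subst f r) := by
  induction l generalizing a with
  | nil => exact Provable.subst hT h f r
  | cons x l ih => exact ih h

theorem genN {l : List Fml} {a : Fml} (h : Pr T (l.map Fml.upN) a) : Pr T l a.allN := by
  induction l generalizing a with
  | nil => exact Provable.genN h
  | cons x l ih =>
    have h₁ : Pr T l (x.upN.allN ➝ a.allN) := mp (of_provable (.distN _ _) l) (ih h)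
    exact mp (l := x :: l) (h₁.weaken x) (of_provable (.vacN _) l)

theorem genS {l : List Fml} {a : Fml} (h : Pr T (l.map Fml.upS) a) : Pr T l a.allS := by
  induction l generalizing a with
  | nil => exact Provable.genS h
  | cons x l ih =>
    have h₁ : Pr T l (x.upS.allS ➝ a.allS) := mp (of_provable (.distS _ _) l) (ih h)
    exact mp (l := x :: l) (h₁.weaken x) (of_provable (.vacS _) l)

/-- Generalization over a fresh free variable: renaming it to `0` and the others to their
successors turns it into generalization over variable `0`. -/
theorem genN_fresh (hT : SubstClosed T) {l : List Fml} {a : Fml} {k : ℕ}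
    (hl : ∀ x ∈ l, x.boundN ≤ k) (ha : a.boundN ≤ k + 1) (h : Pr T l (a.instN (.var k))) :
    Pr T l a.allN := by
  have h' := h.subst hT (fun n => if n = k then .var 0 else .var (n + 1)) id
  apply genN
  convert h' using 1
  · refine List.map_congr_left fun x hx => ?_
    refine Fml.subst_congr _ (fun n hn => ?_) fun _ _ => rfl
    rw [if_neg (ne_of_lt (lt_of_lt_of_le hn (hl x hx)))]
  · rw [Fml.instN_eq, Fml.subst_subst]
    refine (Fml.subst_var a).symm.trans (Fml.subst_congr _ (fun n hn => ?_) fun _ _ => rfl)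
    cases n with
    | zero => simp [scons, NTerm.subst]
    | succ n =>
      have : n ≠ k := by omega
      simp [scons, NTerm.subst, this]

theorem genS_fresh (hT : SubstClosed T) {l : List Fml} {a : Fml} {k : ℕ}
    (hl : ∀ x ∈ l, x.boundS ≤ k) (ha : a.boundS ≤ k + 1) (h : Pr T l (a.instS k)) :
    Pr T l a.allS := by
  have h' := h.subst hT .var (fun n => if n = k then 0 else n + 1)
  apply genS
  convert h' using 1
  · refine List.map_congr_left fun x hx => ?_
    refine Fml.subst_congr _ (fun _ _ => rfl) fun n hn => ?_
    rw [if_neg (ne_of_lt (lt_of_lt_of_le hn (hl x hx)))]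
  · rw [Fml.instS_eq, Fml.subst_subst]
    refine (Fml.subst_var a).symm.trans (Fml.subst_congr _ (fun n hn => rfl) fun n hn => ?_)
    cases n with
    | zero => simp [scons]
    | succ n =>
      have : n ≠ k := by omega
      simp [scons, this]

end Pr

/-! ### Complete Henkin theories -/

/-- `l` decides `a`, with a witness where it refutes a universal formula. -/
def Decides (T : Set Fml) (l : List Fml) (a : Fml) : Prop :=
  Pr T l a ∨ (Pr T l a.neg ∧ (∀ b : Fml, a = b.allN → ∃ t, Pr T l (b.instN t).neg) ∧
    ∀ b : Fml, a = b.allS → ∃ Y, Pr T l (b.instS Y).neg)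

theorem exists_le_bound (g : Fml → ℕ) (l : List Fml) : ∃ k, ∀ x ∈ l, g x ≤ k := by
  induction l with
  | nil => exact ⟨0, by simp⟩
  | cons x l ih =>
    obtain ⟨k, hk⟩ := ih
    refine ⟨max (g x) k, fun y hy => ?_⟩
    rcases List.mem_cons.1 hy with rfl | hy
    · exact le_max_left _ _
    · exact (hk y hy).trans (le_max_right _ _)

/-- Every consistent finite set of hypotheses has a consistent finite extension that
decides `a`. -/
theorem exists_decides {T : Set Fml} (hT : SubstClosed T) {l : List Fml}
    (hl : ¬ Pr T l .falsum) (a : Fml) :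
    ∃ l', ¬ Pr T (l' ++ l) .falsum ∧ Decides T (l' ++ l) a := by
  by_cases h : Pr T (a :: l) .falsum
  · have h₁ : ¬ Pr T (a.neg :: l) .falsum := fun h' => hl (Pr.mp h (Pr.by_contra h'))
    cases a with
    | allN b =>
      obtain ⟨k, hk⟩ := exists_le_bound Fml.boundN (b :: b.allN.neg :: l)
      refine ⟨[(b.instN (.var k)).neg, b.allN.neg], fun h' => h₁ ?_, Or.inr ⟨?_, ?_, ?_⟩⟩
      · refine Pr.mp (Pr.head _ _) (Pr.genN_fresh hT (k := k) (fun x hx => hk x (by simp_all))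
          ((hk b (by simp)).trans (Nat.le_succ k)) (Pr.by_contra h'))
      · exact (Pr.head _ _).weaken _
      · rintro c hc
        cases hc
        exact ⟨_, Pr.head _ _⟩
      · rintro c hc
        cases hc
    | allS b =>
      obtain ⟨k, hk⟩ := exists_le_bound Fml.boundS (b :: b.allS.neg :: l)
      refine ⟨[(b.instS k).neg, b.allS.neg], fun h' => h₁ ?_, Or.inr ⟨?_, ?_, ?_⟩⟩
      · refine Pr.mp (Pr.head _ _) (Pr.genS_fresh hT (k := k) (fun x hx => hk x (by simp_all))
          ((hk b (by simp)).trans (Nat.le_succ k)) (Pr.by_contra h'))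
      · exact (Pr.head _ _).weaken _
      · rintro c hc
        cases hc
      · rintro c hc
        cases hc
        exact ⟨_, Pr.head _ _⟩
    | _ => exact ⟨[_], h₁, Or.inr ⟨Pr.head _ _, by rintro _ ⟨⟩, by rintro _ ⟨⟩⟩⟩
  · exact ⟨[a], h, Or.inl (Pr.head _ _)⟩

/-- An injective numbering of terms. -/
def NTerm.code : NTerm → ℕ
  | var n => 5 * n
  | zero => 1
  | one => 2
  | add s t => 5 * Nat.pair s.code t.code + 3
  | mul s t => 5 * Nat.pair s.code t.code + 4

theorem NTerm.code_injective : Function.Injective NTerm.code := by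
  intro s
  induction s with
  | var n | zero | one =>
    intro t h
    cases t <;> simp only [code] at h <;> first | omega | rfl | (congr 1; omega)
  | add s₁ s₂ h₁ h₂ | mul s₁ s₂ h₁ h₂ =>
    intro t h
    cases t <;> simp only [code] at h <;> first
      | omega
      | (simp only [Nat.add_right_cancel_iff, mul_eq_mul_left_iff, Nat.pair_eq_pair,
          OfNat.ofNat_ne_zero, or_false] at h
         rw [h₁ h.1, h₂ h.2])

/-- An injective numbering of formulas. -/
def Fml.code : Fml → ℕ
  | eq s t => 7 * Nat.pair s.code t.code
  | lt s t => 7 * Nat.pair s.code t.code + 1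
  | mem t X => 7 * Nat.pair t.code X + 2
  | falsum => 3
  | imp a b => 7 * Nat.pair a.code b.code + 4
  | allN a => 7 * a.code + 5
  | allS a => 7 * a.code + 6

theorem Fml.code_injective : Function.Injective Fml.code := by
  intro s
  induction s with
  | eq s₁ s₂ | lt s₁ s₂ | mem s₁ s₂ =>
    intro t h
    cases t <;> simp only [code] at h <;> first
      | omega
      | (simp only [Nat.add_right_cancel_iff, mul_eq_mul_left_iff, Nat.pair_eq_pair,
          OfNat.ofNat_ne_zero, or_false, NTerm.code_injective.eq_iff] at h
         rw [h.1, h.2])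
  | falsum => intro t h; cases t <;> simp only [code] at h <;> first | omega | rfl
  | imp s₁ s₂ h₁ h₂ =>
    intro t h
    cases t <;> simp only [code] at h <;> first
      | omega
      | (simp only [Nat.add_right_cancel_iff, mul_eq_mul_left_iff, Nat.pair_eq_pair,
          OfNat.ofNat_ne_zero, or_false] at h
         rw [h₁ h.1, h₂ h.2])
  | allN s hs | allS s hs =>
    intro t h
    cases t <;> simp only [code] at h <;> first
      | omega
      | (simp only [Nat.add_right_cancel_iff, mul_eq_mul_left_iff,
          OfNat.ofNat_ne_zero, or_false] at h
         rw [hs h])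

/-- A deductively closed, consistent and complete set of formulas in which every refuted
universal formula has a refuted instance. -/
structure IsHenkin (T Γ : Set Fml) : Prop where
  of_provable : ∀ a, Provable T a → a ∈ Γ
  mp : ∀ a b, (a ➝ b) ∈ Γ → a ∈ Γ → b ∈ Γ
  not_falsum : Fml.falsum ∉ Γ
  complete : ∀ a, a ∈ Γ ∨ a.neg ∈ Γ
  allN : ∀ a : Fml, (∀ t, a.instN t ∈ Γ) → a.allN ∈ Γ
  allS : ∀ a : Fml, (∀ Y, a.instS Y ∈ Γ) → a.allS ∈ Γ

theorem exists_isHenkin {T : Set Fml} (hT : SubstClosed T) {a : Fml} (ha : ¬ Provable T a) :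
    ∃ Γ, IsHenkin T Γ ∧ a ∉ Γ := by
  have : Countable Fml := Fml.code_injective.countable
  have : Nonempty Fml := ⟨.falsum⟩
  obtain ⟨enum, henum⟩ := exists_surjective_nat Fml
  have hstart : ¬ Pr T [a.neg] .falsum := fun h => ha (Pr.by_contra (l := []) h)
  choose ext hcons hdec using fun (l : {l // ¬ Pr T l .falsum}) => exists_decides hT l.2
  let c : ℕ → {l // ¬ Pr T l .falsum} := fun n =>
    Nat.rec ⟨[a.neg], hstart⟩ (fun n l => ⟨ext l (enum n) ++ l.1, hcons l (enum n)⟩) n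
  have mono : ∀ {m n : ℕ}, m ≤ n → ∀ {x}, Pr T (c m).1 x → Pr T (c n).1 x := by
    intro m n hmn x hx
    induction hmn with
    | refl => exact hx
    | step _ ih => exact ih.append _
  have dec : ∀ x, ∃ n, Decides T (c n).1 x := by
    intro x
    obtain ⟨n, rfl⟩ := henum x
    exact ⟨n + 1, hdec (c n) (enum n)⟩
  have contr : ∀ {x : Fml} {m n : ℕ}, Pr T (c m).1 x → Pr T (c n).1 x.neg → False := by
    intro x m n h h'
    exact (c (max m n)).2 (Pr.mp (mono (le_max_right m n) h') (mono (le_max_left m n) h))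
  refine ⟨{x | ∃ n, Pr T (c n).1 x}, ⟨?_, ?_, ?_, ?_, ?_, ?_⟩, ?_⟩
  · exact fun x hx => ⟨0, Pr.of_provable hx _⟩
  · rintro x y ⟨m, hm⟩ ⟨n, hn⟩
    exact ⟨max m n, Pr.mp (mono (le_max_left m n) hm) (mono (le_max_right m n) hn)⟩
  · rintro ⟨n, hn⟩
    exact (c n).2 hn
  · intro x
    obtain ⟨n, h | h⟩ := dec x
    · exact Or.inl ⟨n, h⟩
    · exact Or.inr ⟨n, h.1⟩
  · intro x hx
    obtain ⟨n, h | h⟩ := dec x.allN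
    · exact ⟨n, h⟩
    · obtain ⟨t, ht⟩ := h.2.1 x rfl
      obtain ⟨m, hm⟩ := hx t
      exact (contr hm ht).elim
  · intro x hx
    obtain ⟨n, h | h⟩ := dec x.allS
    · exact ⟨n, h⟩
    · obtain ⟨Y, hY⟩ := h.2.2 x rfl
      obtain ⟨m, hm⟩ := hx Y
      exact (contr hm hY).elim
  · rintro ⟨n, hn⟩
    exact contr (m := n) (n := 0) hn (Pr.head _ _)

/-! ### Semantics and the completeness theorem -/

/-- A structure for the language, with a sort of numbers and a sort of sets. Distinct sets may
have the same members. -/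
structure Structure₂ where
  N : Type
  S : Type
  zero : N
  one : N
  add : N → N → N
  mul : N → N → N
  lt : N → N → Prop
  mem : N → S → Prop

/-- The value of a term under an assignment. -/
def NTerm.eval (A : Structure₂) (e : ℕ → A.N) : NTerm → A.N
  | var n => e n
  | zero => A.zero
  | one => A.one
  | add s t => A.add (s.eval A e) (t.eval A e)
  | mul s t => A.mul (s.eval A e) (t.eval A e)

/-- Satisfaction of a formula under an assignment. -/
def Fml.Sat (A : Structure₂) : (ℕ → A.N) → (ℕ → A.S) → Fml → Prop
  | e, _, eq s t => s.eval A e = t.eval A e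
  | e, _, lt s t => A.lt (s.eval A e) (t.eval A e)
  | e, E, mem t X => A.mem (t.eval A e) (E X)
  | _, _, falsum => False
  | e, E, imp a b => a.Sat A e E → b.Sat A e E
  | e, E, allN a => ∀ x, a.Sat A (scons x e) E
  | e, E, allS a => ∀ X, a.Sat A e (scons X E)

namespace IsHenkin

variable {T Γ : Set Fml}

theorem mem_imp (h : IsHenkin T Γ) {a b : Fml} : (a ➝ b) ∈ Γ ↔ (a ∈ Γ → b ∈ Γ) := by
  refine ⟨h.mp a b, fun hab => ?_⟩
  rcases h.complete a with ha | ha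
  · exact h.mp _ _ (h.of_provable _ (.k _ _)) (hab ha)
  · have : Provable T (a.neg ➝ a ➝ b) := Pr.exfalso (l := [a, a.neg])
      (Pr.mp ((Pr.head _ _).weaken _) (Pr.head _ _))
    exact h.mp _ _ (h.of_provable _ this) ha

theorem mem_allN (h : IsHenkin T Γ) {a : Fml} : a.allN ∈ Γ ↔ ∀ t, a.instN t ∈ Γ :=
  ⟨fun ha t => h.mp _ _ (h.of_provable _ (.specN a t)) ha, h.allN a⟩

theorem mem_allS (h : IsHenkin T Γ) {a : Fml} : a.allS ∈ Γ ↔ ∀ Y, a.instS Y ∈ Γ :=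
  ⟨fun ha Y => h.mp _ _ (h.of_provable _ (.specS a Y)) ha, h.allS a⟩

/-- Equals may be replaced in the instances of a formula. -/
theorem replace (h : IsHenkin T Γ) {t u : NTerm} (htu : .eq t u ∈ Γ) (a : Fml)
    (ha : a.instN t ∈ Γ) : a.instN u ∈ Γ :=
  h.mp _ _ (h.mp _ _ (h.of_provable _ (.eqSubst a t u)) htu) ha

theorem up_subst_scons (s t : NTerm) : s.up.subst (scons t .var) = s := by
  rw [NTerm.up, NTerm.subst_subst]
  exact NTerm.subst_var s

/-- Provable equality in a Henkin theory. -/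
def termSetoid (h : IsHenkin T Γ) : Setoid NTerm where
  r t u := .eq t u ∈ Γ
  iseqv :=
    { refl := fun t => h.of_provable _ (.eqRefl t)
      symm := by
        intro t u htu
        have := h.replace htu (.eq (.var 0) t.up)
        simp only [Fml.instN_eq, Fml.subst, up_subst_scons, NTerm.subst, scons_zero] at this
        exact this (h.of_provable _ (.eqRefl t))
      trans := by
        intro t u v htu huv
        have := h.replace huv (.eq t.up (.var 0))
        simp only [Fml.instN_eq, Fml.subst, up_subst_scons, NTerm.subst, scons_zero] at this
        exact this htu }

/-- Congruence of a term function `F` that substitutes into a fixed term `c`. -/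
theorem congr_of_template (h : IsHenkin T Γ) {F : NTerm → NTerm}
    (c : NTerm) (hc : ∀ t, c.subst (scons t .var) = F t) {t u : NTerm} (htu : .eq t u ∈ Γ) :
    .eq (F t) (F u) ∈ Γ := by
  have := h.replace htu (.eq (F t).up c)
  simp only [Fml.instN_eq, Fml.subst, up_subst_scons, hc] at this
  exact this (h.of_provable _ (.eqRefl _))

theorem add_congr (h : IsHenkin T Γ) {t t' u u' : NTerm} (ht : .eq t t' ∈ Γ)
    (hu : .eq u u' ∈ Γ) : .eq (t.add u) (t'.add u') ∈ Γ :=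
  h.termSetoid.trans
    (h.congr_of_template (F := fun x => x.add u) (.add (.var 0) u.up)
      (fun x => by simp only [NTerm.subst, up_subst_scons, scons_zero]) ht)
    (h.congr_of_template (F := fun x => t'.add x) (.add t'.up (.var 0))
      (fun x => by simp only [NTerm.subst, up_subst_scons, scons_zero]) hu)

theorem mul_congr (h : IsHenkin T Γ) {t t' u u' : NTerm} (ht : .eq t t' ∈ Γ)
    (hu : .eq u u' ∈ Γ) : .eq (t.mul u) (t'.mul u') ∈ Γ :=
  h.termSetoid.trans
    (h.congr_of_template (F := fun x => x.mul u) (.mul (.var 0) u.up)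
      (fun x => by simp only [NTerm.subst, up_subst_scons, scons_zero]) ht)
    (h.congr_of_template (F := fun x => t'.mul x) (.mul t'.up (.var 0))
      (fun x => by simp only [NTerm.subst, up_subst_scons, scons_zero]) hu)

theorem lt_congr (h : IsHenkin T Γ) {t t' u u' : NTerm} (ht : .eq t t' ∈ Γ)
    (hu : .eq u u' ∈ Γ) (htu : .lt t u ∈ Γ) : .lt t' u' ∈ Γ := by
  have h₁ := h.replace ht (.lt (.var 0) u.up)
  have h₂ := h.replace hu (.lt t'.up (.var 0))
  simp only [Fml.instN_eq, Fml.subst, up_subst_scons, NTerm.subst, scons_zero] at h₁ h₂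
  exact h₂ (h₁ htu)

theorem mem_congr (h : IsHenkin T Γ) {t t' : NTerm} (X : ℕ) (ht : .eq t t' ∈ Γ)
    (htX : .mem t X ∈ Γ) : .mem t' X ∈ Γ := by
  have h₁ := h.replace ht (.mem (.var 0) X)
  simp only [Fml.instN_eq, Fml.subst, NTerm.subst, scons_zero, id] at h₁
  exact h₁ htX

/-- The structure of terms modulo provable equality, whose sets are the set variables. -/
def termModel (h : IsHenkin T Γ) : Structure₂ where
  N := Quotient h.termSetoid
  S := ℕ
  zero := Quotient.mk _ .zero
  one := Quotient.mk _ .one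
  add := Quotient.map₂ .add fun _ _ ht _ _ hu => h.add_congr ht hu
  mul := Quotient.map₂ .mul fun _ _ ht _ _ hu => h.mul_congr ht hu
  lt := Quotient.lift₂ (fun t u => .lt t u ∈ Γ) fun _ _ _ _ ht hu => propext
    ⟨h.lt_congr ht hu, h.lt_congr (h.termSetoid.symm ht) (h.termSetoid.symm hu)⟩
  mem := fun x X => Quotient.lift (fun t => .mem t X ∈ Γ) (fun _ _ ht => propext
    ⟨h.mem_congr X ht, h.mem_congr X (h.termSetoid.symm ht)⟩) x

theorem eval_termModel (h : IsHenkin T Γ) (f : ℕ → NTerm) (t : NTerm) :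
    t.eval h.termModel (fun n => Quotient.mk h.termSetoid (f n)) =
      Quotient.mk h.termSetoid (t.subst f) := by
  induction t with
  | var n => rfl
  | zero => rfl
  | one => rfl
  | add s t hs ht | mul s t hs ht => simp only [NTerm.eval, hs, ht]; rfl

/-- The truth lemma. -/
theorem sat_termModel (h : IsHenkin T Γ) (a : Fml) (f : ℕ → NTerm) (r : ℕ → ℕ) :
    a.Sat h.termModel (fun n => Quotient.mk h.termSetoid (f n)) r ↔ a.subst f r ∈ Γ := by
  induction a generalizing f r with
  | eq s t =>
    simp only [Fml.Sat, eval_termModel]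
    exact Quotient.eq (r := h.termSetoid)
  | lt s t =>
    simp only [Fml.Sat, eval_termModel]
    rfl
  | mem t X =>
    simp only [Fml.Sat, eval_termModel]
    rfl
  | falsum => exact ⟨False.elim, h.not_falsum⟩
  | imp a b ha hb =>
    simp only [Fml.Sat, Fml.subst, h.mem_imp, ha, hb]
  | allN a ha =>
    simp only [Fml.subst, h.mem_allN, Fml.subst_liftN_instN, Fml.Sat, ← ha, comp_scons]
    exact ⟨fun H t => H _, fun H x => Quotient.inductionOn (motive := fun x =>
      a.Sat h.termModel (scons x _) r) x H⟩
  | allS a ha =>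
    simp only [Fml.subst, h.mem_allS, Fml.subst_liftS_instS, Fml.Sat, ← ha]
    rfl

end IsHenkin

/-- The completeness theorem: a formula that holds in all models of `T` is derivable. -/
theorem provable_of_forall_sat {T : Set Fml} (hT : SubstClosed T) {a : Fml}
    (h : ∀ A : Structure₂, (∀ b ∈ T, ∀ e E, b.Sat A e E) → ∀ e E, a.Sat A e E) :
    Provable T a := by
  by_contra ha
  obtain ⟨Γ, hΓ, haΓ⟩ := exists_isHenkin hT ha
  refine haΓ ?_
  have := h hΓ.termModel (fun b hb e E => ?_) (fun n => Quotient.mk hΓ.termSetoid (.var n)) id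
  · rwa [hΓ.sat_termModel, Fml.subst_var] at this
  · have he : (fun n => Quotient.mk hΓ.termSetoid (e n).out) = e :=
      funext fun n => Quotient.out_eq _
    rw [← he]
    exact (hΓ.sat_termModel b _ E).2 (hΓ.of_provable _ (hT b hb _ _))

/-! ### Substitution instances of the axioms of `RCA₀` -/

theorem IsBounded.subst {a : Fml} (h : IsBounded a) :
    ∀ f r, IsBounded (a.subst f r) := by
  induction h with
  | eq s t => exact fun f r => .eq _ _
  | lt s t => exact fun f r => .lt _ _
  | mem t X => exact fun f r => .mem _ _
  | falsum => exact fun f r => .falsum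
  | imp _ _ ha hb => exact fun f r => (ha f r).imp (hb f r)
  | ball t _ ha =>
    intro f r
    have := IsBounded.ball (t.subst f) (ha (liftN f) r)
    simp only [Fml.ballN, ← NTerm.up_subst_liftN] at this
    exact this
  | bex t _ ha =>
    intro f r
    have := IsBounded.bex (t.subst f) (ha (liftN f) r)
    simp only [Fml.bexN, ← NTerm.up_subst_liftN] at this
    exact this

theorem IsSigma01.subst {a : Fml} (h : IsSigma01 a) (f : ℕ → NTerm) (r : ℕ → ℕ) :
    IsSigma01 (a.subst f r) := by
  obtain ⟨b, hb, rfl⟩ := h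
  exact ⟨b.subst (liftN f) r, hb.subst _ _, rfl⟩

theorem IsPi01.subst {a : Fml} (h : IsPi01 a) (f : ℕ → NTerm) (r : ℕ → ℕ) :
    IsPi01 (a.subst f r) := by
  obtain ⟨b, hb, rfl⟩ := h
  exact ⟨b.subst (liftN f) r, hb.subst _ _, rfl⟩

/-- Two number variables of a theorem may be instantiated at once. -/
theorem Provable.inst₂ {T : Set Fml} {a : Fml} (h : Provable T a) (t u : NTerm) :
    Provable T (a.subst (scons t (scons u .var)) id) := by
  have h₁ := (Provable.specN _ u).mp h.genN.genN
  rw [Fml.instN_eq, Fml.subst] at h₁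
  have h₂ := (Provable.specN _ t).mp h₁
  rwa [Fml.subst_liftN_instN] at h₂

theorem substClosed_RCA0 : SubstClosed RCA0 := by
  intro a ha f r
  have basic := (Provable.ax ha).inst₂ (f 0) (f 1)
  cases ha with
  | induction a h =>
    have := IsAxiomRCA0.induction _ (h.subst (liftN f) r)
    simp only [Fml.subst, Fml.and, Fml.neg, Fml.instN_subst, Fml.succN_subst, NTerm.subst]
    exact .ax this
  | comprehension a b ha hb =>
    have := IsAxiomRCA0.comprehension _ _ (ha.subst (liftN f) r) (hb.subst (liftN f) r)
    simp only [Fml.subst, Fml.and, Fml.iff, Fml.exS, Fml.neg, Fml.upS_subst, NTerm.subst]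
    exact .ax this
  | _ => exact basic

/-! ### Semantics of the defined connectives -/

variable {A : Structure₂}

instance : Zero A.N := ⟨A.zero⟩
instance : One A.N := ⟨A.one⟩
instance : Add A.N := ⟨A.add⟩
instance : Mul A.N := ⟨A.mul⟩
instance : LT A.N := ⟨A.lt⟩
instance : Membership A.N A.S := ⟨fun X x => A.mem x X⟩

namespace NTerm

variable (e : ℕ → A.N)

theorem eval_var (n : ℕ) : (var n).eval A e = e n := rfl
theorem eval_zero : zero.eval A e = 0 := rfl
theorem eval_one : one.eval A e = 1 := rfl
theorem eval_add (s t : NTerm) : (add s t).eval A e = s.eval A e + t.eval A e := rfl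
theorem eval_mul (s t : NTerm) : (mul s t).eval A e = s.eval A e * t.eval A e := rfl

theorem eval_subst (f : ℕ → NTerm) (t : NTerm) :
    (t.subst f).eval A e = t.eval A fun n => (f n).eval A e := by
  induction t with
  | var n => rfl
  | zero => rfl
  | one => rfl
  | add s t hs ht | mul s t hs ht => simp only [subst, eval, hs, ht]

theorem eval_up (x : A.N) (t : NTerm) : t.up.eval A (scons x e) = t.eval A e := by
  rw [up, eval_subst]
  rfl

end NTerm

namespace Fml

theorem sat_subst (a : Fml) (f : ℕ → NTerm) (r : ℕ → ℕ) (e : ℕ → A.N) (E : ℕ → A.S) :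
    (a.subst f r).Sat A e E ↔ a.Sat A (fun n => (f n).eval A e) fun n => E (r n) := by
  induction a generalizing f r e E with
  | eq s t | lt s t => simp only [subst, Sat, NTerm.eval_subst]
  | mem t X => simp only [subst, Sat, NTerm.eval_subst]
  | falsum => rfl
  | imp a b ha hb => simp only [subst, Sat, ha, hb]
  | allN a ha =>
    simp only [subst, Sat, ha]
    refine forall_congr' fun x => iff_of_eq (congrArg (fun e => Sat A e _ a) ?_)
    funext n
    cases n with
    | zero => rfl
    | succ n => exact NTerm.eval_up _ _ _
  | allS a ha =>
    simp only [subst, Sat, ha]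
    refine forall_congr' fun x => iff_of_eq (congrArg (fun E => Sat A _ E a) ?_)
    funext n
    cases n <;> rfl

theorem succN_eq (a : Fml) :
    a.succN = a.subst (scons (.add (.var 0) .one) fun n => .var (n + 1)) id := by
  unfold succN
  congr 1

variable (e : ℕ → A.N) (E : ℕ → A.S)

theorem sat_eq (s t : NTerm) : (eq s t).Sat A e E ↔ s.eval A e = t.eval A e := Iff.rfl
theorem sat_lt (s t : NTerm) : (lt s t).Sat A e E ↔ s.eval A e < t.eval A e := Iff.rfl
theorem sat_mem (t : NTerm) (X : ℕ) : (mem t X).Sat A e E ↔ t.eval A e ∈ E X := Iff.rfl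
theorem sat_imp (a b : Fml) : (imp a b).Sat A e E ↔ (a.Sat A e E → b.Sat A e E) := Iff.rfl
theorem sat_allN (a : Fml) : a.allN.Sat A e E ↔ ∀ x, a.Sat A (scons x e) E := Iff.rfl
theorem sat_allS (a : Fml) : a.allS.Sat A e E ↔ ∀ X, a.Sat A e (scons X E) := Iff.rfl
theorem sat_neg (a : Fml) : a.neg.Sat A e E ↔ ¬ a.Sat A e E := Iff.rfl

theorem sat_and (a b : Fml) : (a ⋏ b).Sat A e E ↔ a.Sat A e E ∧ b.Sat A e E := by
  simp only [and, neg, Sat]; tauto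

theorem sat_or (a b : Fml) : (a ⋎ b).Sat A e E ↔ a.Sat A e E ∨ b.Sat A e E := by
  simp only [or, neg, Sat]; tauto

theorem sat_iff (a b : Fml) : (a ⭤ b).Sat A e E ↔ (a.Sat A e E ↔ b.Sat A e E) := by
  simp only [iff, sat_and, sat_imp]; tauto

theorem sat_exN (a : Fml) : a.exN.Sat A e E ↔ ∃ x, a.Sat A (scons x e) E := by
  simp only [exN, sat_neg, sat_allN, not_forall, not_not]

theorem sat_exS (a : Fml) : a.exS.Sat A e E ↔ ∃ X, a.Sat A e (scons X E) := by
  simp only [exS, sat_neg, sat_allS, not_forall, not_not]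

theorem sat_ballN (t : NTerm) (a : Fml) :
    (ballN t a).Sat A e E ↔ ∀ x, x < t.eval A e → a.Sat A (scons x e) E := by
  simp only [ballN, sat_allN, sat_imp, sat_lt, NTerm.eval_up, NTerm.eval_var, scons_zero]

theorem sat_bexN (t : NTerm) (a : Fml) :
    (bexN t a).Sat A e E ↔ ∃ x, x < t.eval A e ∧ a.Sat A (scons x e) E := by
  simp only [bexN, sat_exN, sat_and, sat_lt, NTerm.eval_up, NTerm.eval_var, scons_zero]

theorem sat_upS (a : Fml) (X : A.S) : a.upS.Sat A e (scons X E) ↔ a.Sat A e E :=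
  sat_subst _ _ _ _ _

end Fml

/-! ### Bounded definability with parameters -/

/-- Functions of an assignment that are given by terms with parameters. -/
class inductive IsTm : ((ℕ → A.N) → A.N) → Prop
  | var (i : ℕ) : IsTm fun v => v i
  | const (c : A.N) : IsTm fun _ => c
  | add (f g) : IsTm f → IsTm g → IsTm fun v => f v + g v
  | mul (f g) : IsTm f → IsTm g → IsTm fun v => f v * g v

/-- Properties of an assignment that are given by `Σ⁰₀` formulas with number and set
parameters. This is a class, so that definability is shown by instance search. -/
class inductive D0 : ((ℕ → A.N) → Prop) → Prop
  | eq (f g) : IsTm f → IsTm g → D0 fun v => f v = g v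
  | lt (f g) : IsTm f → IsTm g → D0 fun v => f v < g v
  | mem (f) (X : A.S) : IsTm f → D0 fun v => f v ∈ X
  | falsum : D0 fun _ => False
  | imp (P Q) : D0 P → D0 Q → D0 fun v => P v → Q v
  | ball (f) (Q : A.N → (ℕ → A.N) → Prop) : IsTm f → D0 (fun v => Q (v 0) fun n => v (n + 1)) →
      D0 fun v => ∀ x, x < f v → Q x v

section

variable (f g : (ℕ → A.N) → A.N) [hf : IsTm f] [hg : IsTm g]
variable (P Q : (ℕ → A.N) → Prop) [hP : D0 P] [hQ : D0 Q]

instance IsTm.instVar (i : ℕ) : IsTm (A := A) fun v => v i := .var i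
instance IsTm.instConst (c : A.N) : IsTm (A := A) fun _ => c := .const c
instance IsTm.instAdd : IsTm fun v => f v + g v := .add f g hf hg
instance IsTm.instMul : IsTm fun v => f v * g v := .mul f g hf hg

/-- Reindexing serves for terms below quantifiers on whose variables they do not depend. -/
instance IsTm.instReindex (ρ : ℕ → ℕ) : IsTm fun v => f fun n => v (ρ n) := by
  induction hf with
  | var i => exact .var (ρ i)
  | const c => exact .const c
  | add f g _ _ hf hg => exact .add _ _ hf hg
  | mul f g _ _ hf hg => exact .mul _ _ hf hg

instance D0.instEq : D0 fun v => f v = g v := .eq f g hf hg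
instance D0.instLt : D0 fun v => f v < g v := .lt f g hf hg
instance D0.instMem (X : A.S) : D0 fun v => f v ∈ X := .mem f X hf
instance D0.instFalse : D0 (A := A) fun _ => False := .falsum
instance D0.instImp : D0 fun v => P v → Q v := .imp P Q hP hQ

instance D0.instBall (R : A.N → (ℕ → A.N) → Prop) [h : D0 fun v => R (v 0) fun n => v (n + 1)] :
    D0 fun v => ∀ x, x < f v → R x v := .ball f R hf h

theorem D0.congr {P Q : (ℕ → A.N) → Prop} (h : ∀ v, P v ↔ Q v) (hP : D0 P) : D0 Q := by
  rwa [← show P = Q from funext fun v => propext (h v)]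

instance D0.instNot : D0 fun v => ¬ P v := D0.instImp P fun _ => False

instance D0.instOr : D0 fun v => P v ∨ Q v :=
  D0.congr (P := fun v => ¬ P v → Q v) (fun v => by tauto) inferInstance

instance D0.instAnd : D0 fun v => P v ∧ Q v :=
  D0.congr (P := fun v => ¬ (P v → ¬ Q v)) (fun v => by tauto) inferInstance

instance D0.instIff : D0 fun v => (P v ↔ Q v) :=
  D0.congr (P := fun v => (P v → Q v) ∧ (Q v → P v)) (fun v => by tauto) inferInstance

instance D0.instBex (R : A.N → (ℕ → A.N) → Prop) [h : D0 fun v => R (v 0) fun n => v (n + 1)] :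
    D0 fun v => ∃ x, x < f v ∧ R x v :=
  D0.congr (P := fun v => ¬ ∀ x, x < f v → ¬ R x v) (fun v => by push Not; rfl) inferInstance

end

/-- The number parameters of a `Σ⁰₀` definition take the odd places of the assignment. -/
def mix {α : Type*} (v p : ℕ → α) (n : ℕ) : α := if n % 2 = 0 then v (n / 2) else p (n / 2)

theorem mix_even {α : Type*} (v p : ℕ → α) (n : ℕ) : mix v p (2 * n) = v n := by
  simp [mix]

theorem mix_odd {α : Type*} (v p : ℕ → α) (n : ℕ) : mix v p (2 * n + 1) = p n := by
  have : (2 * n + 1) / 2 = n := by omega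
  simp [mix, Nat.add_mod, this]

theorem comp_mix {α β : Type*} (h : α → β) (v p : ℕ → α) :
    (fun n => h (mix v p n)) = mix (fun n => h (v n)) fun n => h (p n) := by
  funext n
  unfold mix
  split_ifs <;> rfl

/-- The substitution that makes room for a second parameter sequence. -/
def mergeL : ℕ → NTerm := mix (fun n => .var (2 * n)) fun n => .var (2 * (2 * n) + 1)

/-- The substitution that makes room for a first parameter sequence. -/
def mergeR : ℕ → NTerm := mix (fun n => .var (2 * n)) fun n => .var (2 * (2 * n + 1) + 1)

theorem eval_mergeL (v p q : ℕ → A.N) :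
    (fun n => (mergeL n).eval A (mix v (mix p q))) = mix v p := by
  rw [mergeL, comp_mix (NTerm.eval A (mix v (mix p q)))]
  simp only [NTerm.eval_var, mix_even, mix_odd]

theorem eval_mergeR (v p q : ℕ → A.N) :
    (fun n => (mergeR n).eval A (mix v (mix p q))) = mix v q := by
  rw [mergeR, comp_mix (NTerm.eval A (mix v (mix p q)))]
  simp only [NTerm.eval_var, mix_even, mix_odd]

/-- `t` with the parameters `p` defines `f`. -/
def DefinesTm (t : NTerm) (p : ℕ → A.N) (f : (ℕ → A.N) → A.N) : Prop :=
  ∀ v, t.eval A (mix v p) = f v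

/-- `b` with the number parameters `p` and the set parameters `E` defines `P`. -/
def Defines (b : Fml) (p : ℕ → A.N) (E : ℕ → A.S) (P : (ℕ → A.N) → Prop) : Prop :=
  IsBounded b ∧ ∀ v, b.Sat A (mix v p) E ↔ P v

section

variable {t : NTerm} {f : (ℕ → A.N) → A.N} {b : Fml} {P : (ℕ → A.N) → Prop} {p : ℕ → A.N}
  {E : ℕ → A.S}

theorem DefinesTm.left (h : DefinesTm t p f) (q : ℕ → A.N) :
    DefinesTm (t.subst mergeL) (mix p q) f := fun v => by
  rw [NTerm.eval_subst, eval_mergeL, h v]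

theorem DefinesTm.right (h : DefinesTm t p f) (q : ℕ → A.N) :
    DefinesTm (t.subst mergeR) (mix q p) f := fun v => by
  rw [NTerm.eval_subst, eval_mergeR, h v]

theorem Defines.left (h : Defines b p E P) (q : ℕ → A.N) (F : ℕ → A.S) :
    Defines (b.subst mergeL fun n => 2 * n) (mix p q) (mix E F) P := by
  refine ⟨h.1.subst _ _, fun v => ?_⟩
  simp only [Fml.sat_subst, eval_mergeL, mix_even, h.2 v]

theorem Defines.right (h : Defines b p E P) (q : ℕ → A.N) (F : ℕ → A.S) :
    Defines (b.subst mergeR fun n => 2 * n + 1) (mix q p) (mix F E) P := by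
  refine ⟨h.1.subst _ _, fun v => ?_⟩
  simp only [Fml.sat_subst, eval_mergeR, mix_odd, h.2 v]

theorem IsTm.exists_definesTm (h : IsTm f) : ∃ t p, DefinesTm t p f := by
  induction h with
  | var i => exact ⟨.var (2 * i), fun _ => 0, fun v => mix_even _ _ _⟩
  | const c => exact ⟨.var 1, fun _ => c, fun v => mix_odd _ _ 0⟩
  | add f g _ _ hf hg =>
    obtain ⟨t, p, ht⟩ := hf
    obtain ⟨u, q, hu⟩ := hg
    refine ⟨.add (t.subst mergeL) (u.subst mergeR), mix p q, fun v => ?_⟩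
    rw [NTerm.eval_add, ht.left q v, hu.right p v]
  | mul f g _ _ hf hg =>
    obtain ⟨t, p, ht⟩ := hf
    obtain ⟨u, q, hu⟩ := hg
    refine ⟨.mul (t.subst mergeL) (u.subst mergeR), mix p q, fun v => ?_⟩
    rw [NTerm.eval_mul, ht.left q v, hu.right p v]

/-- The link from the semantic class to formulas. -/
theorem D0.exists_defines [Nonempty A.S] (h : D0 P) : ∃ b p E, Defines b p E P := by
  obtain ⟨X₀⟩ := ‹Nonempty A.S›
  induction h with
  | eq f g hf hg =>
    obtain ⟨t, p, ht⟩ := hf.exists_definesTm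
    obtain ⟨u, q, hu⟩ := hg.exists_definesTm
    refine ⟨.eq (t.subst mergeL) (u.subst mergeR), mix p q, fun _ => X₀, .eq _ _, fun v => ?_⟩
    rw [Fml.sat_eq, ht.left q v, hu.right p v]
  | lt f g hf hg =>
    obtain ⟨t, p, ht⟩ := hf.exists_definesTm
    obtain ⟨u, q, hu⟩ := hg.exists_definesTm
    refine ⟨.lt (t.subst mergeL) (u.subst mergeR), mix p q, fun _ => X₀, .lt _ _, fun v => ?_⟩
    rw [Fml.sat_lt, ht.left q v, hu.right p v]
  | mem f X hf =>
    obtain ⟨t, p, ht⟩ := hf.exists_definesTm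
    refine ⟨.mem t 0, p, fun _ => X, .mem _ _, fun v => ?_⟩
    rw [Fml.sat_mem, ht v]
  | falsum => exact ⟨.falsum, fun _ => 0, fun _ => X₀, .falsum, fun v => Iff.rfl⟩
  | imp P Q _ _ hP hQ =>
    obtain ⟨a, p, E, ha⟩ := hP
    obtain ⟨b, q, F, hb⟩ := hQ
    refine ⟨.imp _ _, mix p q, mix E F, (ha.left q F).1.imp (hb.right p E).1, fun v => ?_⟩
    rw [Fml.sat_imp, (ha.left q F).2 v, (hb.right p E).2 v]
  | ball f Q hf _ hQ =>
    obtain ⟨t, q, ht⟩ := hf.exists_definesTm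
    obtain ⟨b, p, E, hb⟩ := hQ
    -- The quantified variable becomes the first of the assignment.
    refine ⟨.ballN (t.subst mergeL) ((b.subst mergeR id).subst
      (mix (scons (.var 0) fun n => .var (2 * n + 1)) fun n => .var (2 * n + 2)) id),
      mix q p, E, .ball _ ((hb.1.subst _ _).subst _ _), fun v => ?_⟩
    rw [Fml.sat_ballN, ht.left p v]
    refine forall_congr' fun x => imp_congr_right fun _ => ?_
    rw [Fml.sat_subst, comp_mix (NTerm.eval A (scons x (mix v (mix q p)))),
      comp_scons (NTerm.eval A (scons x (mix v (mix q p))))]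
    simp only [NTerm.eval_var, scons_zero, scons_succ, mix_even, mix_odd, id]
    rw [Fml.sat_subst, eval_mergeR]
    exact hb.2 _

end

/-! ### Induction and comprehension in a model of `RCA₀` -/

/-- A model of `RCA₀`. There has to be a set: over an empty sort of sets there are no assignments,
and every formula would hold vacuously. -/
structure RCAModel extends Structure₂ where
  nonempty : Nonempty S
  sat : ∀ a ∈ RCA0, ∀ e E, a.Sat toStructure₂ e E

variable {M : RCAModel}

instance : Nonempty M.S := M.nonempty

/-- `Σ⁰₁` induction, for the formula `∃ w, P w x` in `x`. The witness is variable `0` of the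
assignment, and `x` is variable `1`. -/
theorem sigma_induction {P : M.N → M.N → Prop} [hP : D0 fun v => P (v 0) (v 1)]
    (h0 : ∃ w, P w 0) (hs : ∀ x, (∃ w, P w x) → ∃ w, P w (x + 1)) (x : M.N) : ∃ w, P w x := by
  obtain ⟨b, p, E, hb⟩ := hP.exists_defines
  let c := b.subst (mix (scons (.var 0) fun _ => .var 1) fun n => .var (n + 2)) id
  have hc : ∀ w x, c.Sat M.toStructure₂ (scons w (scons x p)) E ↔ P w x := by
    intro w x
    rw [Fml.sat_subst, comp_mix (NTerm.eval _ (scons w (scons x p))),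
      comp_scons (NTerm.eval _ (scons w (scons x p)))]
    exact hb.2 (scons w fun _ => x)
  have := M.sat _ (.induction c.exN ⟨c, hb.1.subst _ _, rfl⟩) p E
  simp only [Fml.sat_imp, Fml.sat_and, Fml.sat_allN] at this
  have key : ∀ x, c.exN.Sat M.toStructure₂ (scons x p) E ↔ ∃ w, P w x := by
    intro x
    simp only [Fml.sat_exN, hc]
  refine (key x).1 (this ⟨?_, fun x hx => ?_⟩ x)
  · rw [Fml.instN_eq, Fml.sat_subst, comp_scons (NTerm.eval _ p)]
    exact (key 0).2 h0
  · rw [Fml.succN_eq, Fml.sat_subst, comp_scons (NTerm.eval _ (scons x p))]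
    exact (key (x + 1)).2 (hs x ((key x).1 hx))

/-- `Δ⁰₁` comprehension, with the same convention on variables. -/
theorem delta_comprehension {P Q : M.N → M.N → Prop}
    [hP : D0 fun v => P (v 0) (v 1)] [hQ : D0 fun v => Q (v 0) (v 1)]
    (h : ∀ x, (∃ w, P w x) ↔ ∀ w, Q w x) : ∃ X : M.S, ∀ x, x ∈ X ↔ ∃ w, P w x := by
  obtain ⟨b, p, E, hb⟩ := hP.exists_defines
  obtain ⟨b', p', E', hb'⟩ := hQ.exists_defines
  replace hb := hb.left p' E'
  replace hb' := hb'.right p E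
  generalize b.subst mergeL (fun n => 2 * n) = b at hb
  generalize b'.subst mergeR (fun n => 2 * n + 1) = b' at hb'
  generalize mix p p' = p at hb hb'
  generalize mix E E' = E at hb hb'
  let f : ℕ → NTerm := mix (scons (.var 0) fun _ => .var 1) fun n => .var (n + 2)
  have hf : ∀ w x, (fun n => (f n).eval M.toStructure₂ (scons w (scons x p))) =
      mix (scons w fun _ => x) p := by
    intro w x
    rw [comp_mix (NTerm.eval _ (scons w (scons x p))),
      comp_scons (NTerm.eval _ (scons w (scons x p)))]
    rfl
  have hc : ∀ w x, (b.subst f id).Sat M.toStructure₂ (scons w (scons x p)) E ↔ P w x := by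
    intro w x
    rw [Fml.sat_subst, hf]
    exact hb.2 (scons w fun _ => x)
  have hc' : ∀ w x, (b'.subst f id).Sat M.toStructure₂ (scons w (scons x p)) E ↔ Q w x := by
    intro w x
    rw [Fml.sat_subst, hf]
    exact hb'.2 (scons w fun _ => x)
  have := M.sat _ (.comprehension (b.subst f id).exN (b'.subst f id).allN
    ⟨_, hb.1.subst _ _, rfl⟩ ⟨_, hb'.1.subst _ _, rfl⟩) p E
  simp only [Fml.sat_imp, Fml.sat_allN, Fml.sat_iff, Fml.sat_exN, Fml.sat_exS, Fml.sat_upS,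
    Fml.sat_mem, hc, hc', NTerm.eval_var, scons_zero] at this
  exact this h

theorem bounded_induction {P : M.N → Prop} [hP : D0 fun v => P (v 1)] (h0 : P 0)
    (hs : ∀ x, P x → P (x + 1)) (x : M.N) : P x :=
  (sigma_induction (P := fun _ x => P x) ⟨0, h0⟩ (fun x ⟨w, hw⟩ => ⟨w, hs x hw⟩) x).choose_spec

theorem bounded_comprehension (P : M.N → Prop) [hP : D0 fun v => P (v 1)] :
    ∃ X : M.S, ∀ x, x ∈ X ↔ P x := by
  obtain ⟨X, hX⟩ := delta_comprehension (P := fun _ x => P x) (Q := fun _ x => P x)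
    fun x => ⟨fun h _ => h.choose_spec, fun h => ⟨0, h 0⟩⟩
  exact ⟨X, fun x => (hX x).trans ⟨fun h => h.choose_spec, fun h => ⟨0, h⟩⟩⟩

/-! ### Arithmetic in a model of `RCA₀` -/

namespace RCAModel

/-- Evaluates an axiom of `RCA₀` in the first two number variables. -/
theorem sat₂ (a : Fml) (ha : IsAxiomRCA0 a) (x y : M.N) :
    a.Sat M.toStructure₂ (scons x fun _ => y) fun _ => M.nonempty.some :=
  M.sat a ha _ _

theorem succ_ne_zero (x : M.N) : x + 1 ≠ 0 := sat₂ _ .succ_ne_zero x x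
theorem succ_inj {x y : M.N} (h : x + 1 = y + 1) : x = y := sat₂ _ .succ_inj x y h
theorem add_zero' (x : M.N) : x + 0 = x := sat₂ _ .add_zero x x
theorem add_succ (x y : M.N) : x + (y + 1) = x + y + 1 := sat₂ _ .add_succ x y
theorem mul_zero' (x : M.N) : x * 0 = 0 := sat₂ _ .mul_zero x x
theorem mul_succ (x y : M.N) : x * (y + 1) = x * y + x := sat₂ _ .mul_succ x y
theorem not_lt_zero' (x : M.N) : ¬ x < 0 := sat₂ _ .not_lt_zero x x
theorem lt_succ (x y : M.N) : x < y + 1 ↔ x < y ∨ x = y := by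
  have := sat₂ _ .lt_succ x y
  rwa [Fml.sat_iff, Fml.sat_or] at this

theorem zero_add' (x : M.N) : 0 + x = x :=
  bounded_induction (P := fun x : M.N => 0 + x = x) (add_zero' 0)
    (fun x h => by rw [add_succ, h]) x

theorem succ_add (x y : M.N) : x + 1 + y = x + y + 1 :=
  bounded_induction (P := fun y : M.N => x + 1 + y = x + y + 1) (by rw [add_zero', add_zero'])
    (fun y h => by rw [add_succ, h, add_succ]) y

theorem add_comm' (x y : M.N) : x + y = y + x :=
  bounded_induction (P := fun y : M.N => x + y = y + x) (by rw [add_zero', zero_add'])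
    (fun y h => by rw [add_succ, h, succ_add]) y

theorem add_assoc' (x y z : M.N) : x + y + z = x + (y + z) :=
  bounded_induction (P := fun z : M.N => x + y + z = x + (y + z)) (by simp only [add_zero'])
    (fun z h => by simp only [add_succ, h]) z

theorem zero_mul' (x : M.N) : 0 * x = 0 :=
  bounded_induction (P := fun x : M.N => 0 * x = 0) (mul_zero' 0)
    (fun x h => by rw [mul_succ, h, add_zero']) x

theorem succ_mul (x y : M.N) : (x + 1) * y = x * y + y :=
  bounded_induction (P := fun y : M.N => (x + 1) * y = x * y + y)
    (by simp only [mul_zero', add_zero'])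
    (fun y h => by
      rw [mul_succ, mul_succ, h, add_succ, add_succ, add_assoc', add_assoc', add_comm' y,
        succ_add, ← add_assoc', ← add_assoc']) y

theorem mul_comm' (x y : M.N) : x * y = y * x :=
  bounded_induction (P := fun y : M.N => x * y = y * x) (by rw [mul_zero', zero_mul'])
    (fun y h => by rw [mul_succ, h, succ_mul]) y

theorem mul_add' (x y z : M.N) : x * (y + z) = x * y + x * z :=
  bounded_induction (P := fun z : M.N => x * (y + z) = x * y + x * z)
    (by simp only [mul_zero', add_zero'])
    (fun z h => by rw [add_succ, mul_succ, mul_succ, h, add_assoc']) z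

theorem mul_assoc' (x y z : M.N) : x * y * z = x * (y * z) :=
  bounded_induction (P := fun z : M.N => x * y * z = x * (y * z)) (by simp only [mul_zero'])
    (fun z h => by rw [mul_succ, mul_succ, h, mul_add']) z

theorem mul_one' (x : M.N) : x * 1 = x := by
  rw [← zero_add' (1 : M.N), mul_succ, mul_zero', zero_add']

theorem add_right_cancel'' {x y z : M.N} : x + z = y + z → x = y :=
  bounded_induction (P := fun z : M.N => x + z = y + z → x = y) (by simp only [add_zero', imp_self])
    (fun z h h' => h (succ_inj (by rwa [add_succ, add_succ] at h'))) z

theorem lt_add_succ (x z : M.N) : x < x + (z + 1) :=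
  bounded_induction (P := fun z : M.N => x < x + (z + 1))
    (by rw [add_succ, add_zero']; exact (lt_succ _ _).2 (Or.inr rfl))
    (fun z h => by rw [add_succ]; exact (lt_succ _ _).2 (Or.inl h)) z

theorem lt_iff_exists {x y : M.N} : x < y ↔ ∃ z, x + (z + 1) = y := by
  refine ⟨fun h => ?_, fun ⟨z, hz⟩ => hz ▸ lt_add_succ x z⟩
  refine (sigma_induction (P := fun z y : M.N => x < y → x + (z + 1) = y)
    ⟨0, fun h => (not_lt_zero' _ h).elim⟩ (fun y ⟨z, hz⟩ => ?_) y).imp fun z hz => hz h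
  by_cases h : x < y
  · exact ⟨z + 1, fun _ => by rw [add_succ, hz h]⟩
  · refine ⟨0, fun h' => ?_⟩
    rcases (lt_succ _ _).1 h' with h' | rfl
    · exact (h h').elim
    · rw [zero_add']

theorem eq_zero_or_succ (x : M.N) : x = 0 ∨ ∃ y, x = y + 1 := by
  obtain ⟨w, hw⟩ := sigma_induction (P := fun w x : M.N => x = 0 ∨ x = w + 1) ⟨0, Or.inl rfl⟩
    (fun x _ => ⟨x, Or.inr rfl⟩) x
  exact hw.imp_right fun h => ⟨w, h⟩

theorem lt_irrefl' (x : M.N) : ¬ x < x := by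
  rw [lt_iff_exists]
  rintro ⟨z, hz⟩
  refine succ_ne_zero z (add_right_cancel'' (z := x) ?_)
  rw [add_comm', hz, zero_add']

theorem lt_trans' {x y z : M.N} (h : x < y) (h' : y < z) : x < z := by
  obtain ⟨a, rfl⟩ := lt_iff_exists.1 h
  obtain ⟨b, rfl⟩ := lt_iff_exists.1 h'
  rw [add_assoc', add_succ]
  exact lt_add_succ _ _

theorem trichotomy (x y : M.N) : x < y ∨ x = y ∨ y < x := by
  refine bounded_induction (P := fun y : M.N => x < y ∨ x = y ∨ y < x) ?_ (fun y h => ?_) y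
  · rcases eq_zero_or_succ x with h | ⟨z, rfl⟩
    · exact Or.inr (Or.inl h)
    · refine Or.inr (Or.inr ?_)
      have := lt_add_succ 0 z
      rwa [zero_add'] at this
  · rcases h with h | rfl | h
    · exact Or.inl ((lt_succ _ _).2 (Or.inl h))
    · exact Or.inl ((lt_succ _ _).2 (Or.inr rfl))
    · obtain ⟨z, rfl⟩ := lt_iff_exists.1 h
      rcases eq_zero_or_succ z with rfl | ⟨z, rfl⟩
      · exact Or.inr (Or.inl (by rw [zero_add']))
      · refine Or.inr (Or.inr ?_)
        rw [add_succ, ← succ_add]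
        exact lt_add_succ _ _

instance : CommSemiring M.N where
  add_assoc := add_assoc'
  zero_add := zero_add'
  add_zero := add_zero'
  add_comm := add_comm'
  mul_assoc := mul_assoc'
  one_mul x := by rw [mul_comm', mul_one']
  mul_one := mul_one'
  mul_comm := mul_comm'
  zero_mul := zero_mul'
  mul_zero := mul_zero'
  left_distrib := mul_add'
  right_distrib x y z := by simp only [mul_comm' _ z, mul_add']
  nsmul := nsmulRec

noncomputable instance : LinearOrder M.N where
  le x y := x < y ∨ x = y
  le_refl x := Or.inr rfl
  le_trans x y z := by
    rintro (h | rfl) (h' | rfl)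
    · exact Or.inl (lt_trans' h h')
    · exact Or.inl h
    · exact Or.inl h'
    · exact Or.inr rfl
  lt_iff_le_not_ge x y := by
    refine ⟨fun h => ⟨Or.inl h, ?_⟩, ?_⟩
    · rintro (h' | rfl)
      · exact lt_irrefl' _ (lt_trans' h h')
      · exact lt_irrefl' _ h
    · rintro ⟨h | rfl, h'⟩
      · exact h
      · exact (h' (Or.inr rfl)).elim
  le_antisymm x y := by
    rintro (h | rfl) (h' | h')
    · exact (lt_irrefl' _ (lt_trans' h h')).elim
    · exact h'.symm
    · rfl
    · rfl
  le_total x y := by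
    rcases trichotomy x y with h | h | h
    · exact Or.inl (Or.inl h)
    · exact Or.inl (Or.inr h)
    · exact Or.inr (Or.inl h)
  toDecidableLE := Classical.decRel _

theorem le_iff_exists {x y : M.N} : x ≤ y ↔ ∃ z, y = x + z := by
  constructor
  · rintro (h | rfl)
    · obtain ⟨z, rfl⟩ := lt_iff_exists.1 h
      exact ⟨z + 1, rfl⟩
    · exact ⟨0, (add_zero _).symm⟩
  · rintro ⟨z, rfl⟩
    rcases eq_zero_or_succ z with rfl | ⟨z, rfl⟩
    · exact Or.inr (add_zero _).symm
    · exact Or.inl (lt_add_succ _ _)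

instance : IsOrderedCancelAddMonoid M.N where
  add_le_add_left x y h z := by
    obtain ⟨w, rfl⟩ := le_iff_exists.1 h
    exact le_iff_exists.2 ⟨w, by ring⟩
  le_of_add_le_add_left x y z h := by
    obtain ⟨w, hw⟩ := le_iff_exists.1 h
    refine le_iff_exists.2 ⟨w, add_right_cancel'' (z := x) ?_⟩
    rw [add_comm, hw]; ring

instance : CanonicallyOrderedAdd M.N where
  exists_add_of_le h := le_iff_exists.1 h
  le_add_self _ y := le_iff_exists.2 ⟨y, add_comm _ _⟩
  le_self_add _ y := le_iff_exists.2 ⟨y, rfl⟩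

theorem lt_add_one_iff {x y : M.N} : x < y + 1 ↔ x ≤ y := lt_succ x y

instance : Nontrivial M.N := ⟨0, 1, fun h => succ_ne_zero (0 : M.N) (by rw [zero_add, ← h])⟩

theorem add_one_le_iff {x y : M.N} : x + 1 ≤ y ↔ x < y := by
  rw [← not_lt, lt_add_one_iff, not_le]

theorem mul_lt_mul_left_of_pos {x y z : M.N} (hx : 0 < x) (h : y < z) : x * y < x * z := by
  obtain ⟨z, rfl⟩ := lt_iff_exists.1 h
  obtain ⟨x, rfl⟩ := lt_iff_exists.1 hx
  exact lt_iff_exists.2 ⟨x * z + x + z, by ring⟩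

instance : IsStrictOrderedRing M.N where
  add_le_add_left x y h z := add_le_add_left h z
  le_of_add_le_add_left x y z h := le_of_add_le_add_left h
  zero_le_one := zero_le
  exists_pair_ne := ⟨0, 1, zero_ne_one⟩
  mul_lt_mul_of_pos_left x hx y z h := mul_lt_mul_left_of_pos hx h
  mul_lt_mul_of_pos_right x hx y z h := by
    simp only [mul_comm _ x]
    exact mul_lt_mul_left_of_pos hx h

/-- The least number principle for bounded predicates. -/
theorem exists_least {P : M.N → Prop} (hP : ∀ (f : (ℕ → M.N) → M.N) [IsTm f], D0 fun v => P (f v))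
    {x : M.N} (hx : P x) : ∃ y, P y ∧ ∀ z < y, ¬ P z := by
  by_contra! h
  have : ∀ z, ∀ y, y < z → ¬ P y := by
    refine bounded_induction (P := fun z : M.N => ∀ y, y < z → ¬ P y)
      (fun y hy => (not_lt_zero' _ hy).elim) fun z hz y hy hPy => ?_
    obtain ⟨u, hu, hPu⟩ := h y hPy
    exact hz u (hu.trans_le (lt_add_one_iff.1 hy)) hPu
  exact this (x + 1) x (lt_add_one_iff.2 le_rfl) hx

/-! ### Divisibility -/

theorem dvd_of_dvd_add {p x y : M.N} (hx : p ∣ x) (h : p ∣ x + y) : p ∣ y := by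
  obtain ⟨v, rfl⟩ := hx
  obtain ⟨u, hu⟩ := h
  rcases le_total v u with huv | huv
  · obtain ⟨w, rfl⟩ := le_iff_exists.1 huv
    exact ⟨w, add_left_cancel (hu.trans (mul_add _ _ _))⟩
  · obtain ⟨w, rfl⟩ := le_iff_exists.1 huv
    have : p * w + y = 0 :=
      add_left_cancel (a := p * u) (by rw [← add_assoc, ← mul_add, hu, add_zero])
    rw [(add_eq_zero.1 this).2]
    exact dvd_zero p

theorem dvd_iff {a b : M.N} : a ∣ b ↔ ∃ q, q < b + 1 ∧ b = q * a := by
  refine ⟨fun ⟨q, hq⟩ => ?_, fun ⟨q, _, hq⟩ => ⟨q, hq.trans (mul_comm _ _)⟩⟩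
  rcases eq_zero_or_succ a with rfl | ⟨a, rfl⟩
  · exact ⟨0, lt_add_one_iff.2 zero_le, by rw [hq, zero_mul, mul_zero]⟩
  · refine ⟨q, lt_add_one_iff.2 (le_iff_exists.2 ⟨a * q, ?_⟩), by rw [hq, mul_comm]⟩
    rw [hq]; ring

instance {f g : (ℕ → M.N) → M.N} [IsTm f] [IsTm g] : D0 fun v => f v ∣ g v :=
  D0.congr (P := fun v => ∃ q, q < g v + 1 ∧ g v = q * f v) (fun _ => dvd_iff.symm) inferInstance

/-- The moduli `m(i + 1) + 1` are pairwise coprime when `m` is divisible by `1, …, l`. -/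
theorem dvd_of_dvd_mul_modulus {l m n i j : M.N} (hm : ∀ d, d < l → d + 1 ∣ m) (hi : i < l)
    (hj : j < l) (hij : i ≠ j) (h : m * (i + 1) + 1 ∣ n * (m * (j + 1) + 1)) :
    m * (i + 1) + 1 ∣ n := by
  have key : ∃ d, d < l ∧ m * (i + 1) + 1 ∣ n * m * (d + 1) := by
    rcases lt_or_gt_of_ne hij with hij | hij
    · obtain ⟨d, rfl⟩ := lt_iff_exists.1 hij
      refine ⟨d, lt_of_lt_of_le (lt_add_one_iff.2 le_rfl) ((le_add_self).trans hj.le), ?_⟩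
      refine dvd_of_dvd_add (Dvd.intro_left n rfl) (h.trans (dvd_of_eq ?_))
      ring
    · obtain ⟨d, rfl⟩ := lt_iff_exists.1 hij
      refine ⟨d, lt_of_lt_of_le (lt_add_one_iff.2 le_rfl) ((le_add_self).trans hi.le), ?_⟩
      refine dvd_of_dvd_add h ⟨n, ?_⟩
      ring
  obtain ⟨d, hd, hdvd⟩ := key
  obtain ⟨e, he⟩ := hm d hd
  -- Modulo `m(i + 1) + 1` the number `m(i + 1)` is `-1`, hence `m` is invertible.
  have h₁ : m * (i + 1) + 1 ∣ n * (m * (i + 1)) * (m * (i + 1)) := by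
    refine (hdvd.mul_right (e * (i + 1) * (i + 1))).trans (dvd_of_eq ?_)
    calc n * m * (d + 1) * (e * (i + 1) * (i + 1))
        = n * m * (i + 1) * (i + 1) * ((d + 1) * e) := by ring
      _ = n * m * (i + 1) * (i + 1) * m := by rw [← he]
      _ = _ := by ring
  have h₂ : m * (i + 1) + 1 ∣ n * (m * (i + 1)) :=
    dvd_of_dvd_add h₁ ⟨n * (m * (i + 1)), by ring⟩
  exact dvd_of_dvd_add h₂ ⟨n, by ring⟩

/-- A positive common multiple of `1, …, l` takes the place of `l!`. -/
theorem exists_modulus (l : M.N) : ∃ m : M.N, 0 < m ∧ ∀ d, d < l → d + 1 ∣ m := by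
  refine sigma_induction (P := fun m l : M.N => 0 < m ∧ ∀ d, d < l → d + 1 ∣ m)
    ⟨1, zero_lt_one, fun d hd => (not_lt_zero' _ hd).elim⟩ (fun l ⟨m, h0, hm⟩ => ?_) l
  refine ⟨m * (l + 1), mul_pos h0 (lt_add_one_iff.2 zero_le), fun d hd => ?_⟩
  rcases (lt_succ _ _).1 hd with hd | rfl
  · exact (hm d hd).mul_right _
  · exact Dvd.intro_left _ rfl

/-- Gödel's `β`-lemma: below `l`, any set `X` is coded by which moduli divide a number `n`. By
induction on `j`, the part of `X` below `j` is coded: a new element multiplies `n` by its modulus,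
which by coprimality adds no other divisor among the moduli. -/
theorem exists_beta (X : M.S) (l : M.N) :
    ∃ m n : M.N, ∀ i, i < l → (m * (i + 1) + 1 ∣ n ↔ i ∈ X) := by
  obtain ⟨m, h0, hm⟩ := exists_modulus l
  have : ∀ j, ∃ n : M.N, ∀ i, i < l → (m * (i + 1) + 1 ∣ n ↔ i < j ∧ i ∈ X) := by
    refine fun j => sigma_induction
      (P := fun n j : M.N => ∀ i, i < l → (m * (i + 1) + 1 ∣ n ↔ i < j ∧ i ∈ X)) ?_ ?_ j
    · refine ⟨1, fun i _ => ⟨fun h => ?_, fun h => (not_lt_zero' _ h.1).elim⟩⟩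
      obtain ⟨c, hc⟩ := h
      rcases eq_zero_or_succ c with rfl | ⟨c, rfl⟩
      · simp at hc
      · have : m * (i + 1) = 0 := by
          have h' : (0 : M.N) = m * (i + 1) * (c + 1) + c :=
            add_right_cancel (b := 1) (by rw [zero_add]; exact hc.trans (by ring))
          exact (mul_eq_zero.1 (add_eq_zero.1 h'.symm).1).resolve_right (succ_ne_zero c)
        rcases mul_eq_zero.1 this with h | h
        · exact (h0.ne' h).elim
        · exact (succ_ne_zero i h).elim
    · rintro j ⟨n, hn⟩
      by_cases hj : j < l ∧ j ∈ X
      · refine ⟨n * (m * (j + 1) + 1), fun i hi => ?_⟩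
        by_cases hij : i = j
        · subst hij
          exact ⟨fun _ => ⟨lt_add_one_iff.2 le_rfl, hj.2⟩, fun _ => Dvd.intro_left _ rfl⟩
        · rw [lt_succ, or_iff_left hij, ← hn i hi]
          exact ⟨dvd_of_dvd_mul_modulus hm hi hj.1 hij, fun h => h.mul_right _⟩
      · refine ⟨n, fun i hi => ?_⟩
        rw [hn i hi, lt_succ]
        refine ⟨fun h => ⟨Or.inl h.1, h.2⟩, fun ⟨h, h'⟩ => ⟨h.resolve_right ?_, h'⟩⟩
        rintro rfl
        exact hj ⟨hi, h'⟩
  obtain ⟨n, hn⟩ := this l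
  exact ⟨m, n, fun i hi => (hn i hi).trans (and_iff_right hi)⟩

/-! ### Pairs -/

/-- The pairing function of the language. -/
def npair (x y : M.N) : M.N := (x + y) * (x + y) + x

instance {f g : (ℕ → M.N) → M.N} [hf : IsTm f] [hg : IsTm g] : IsTm fun v => npair (f v) (g v) :=
  inferInstanceAs (IsTm fun v => (f v + g v) * (f v + g v) + f v)

theorem npair_injective {x y x' y' : M.N} (h : npair x y = npair x' y') : x = x' ∧ y = y' := by
  have key : ∀ {x y x' y' : M.N}, x + y < x' + y' → npair x y < npair x' y' := by
    intro x y x' y' h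
    obtain ⟨z, hz⟩ := lt_iff_exists.1 h
    refine lt_iff_exists.2 ⟨y + (x + y) + 2 * (x + y) * z + 2 * z + z * z + x', ?_⟩
    simp only [npair, ← hz]
    ring
  have hs : x + y = x' + y' := by
    rcases lt_trichotomy (x + y) (x' + y') with h' | h' | h'
    · exact ((key h').ne h).elim
    · exact h'
    · exact ((key h').ne' h).elim
  simp only [npair, hs] at h
  have hx := add_left_cancel h
  subst hx
  exact ⟨rfl, add_left_cancel hs⟩

theorem left_le_npair (x y : M.N) : x ≤ npair x y := le_add_self

theorem right_le_npair (x y : M.N) : y ≤ npair x y := by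
  rcases eq_zero_or_succ (x + y) with h | ⟨z, hz⟩
  · rw [(add_eq_zero.1 h).2]
    exact zero_le
  · calc y ≤ x + y := le_add_self
      _ ≤ npair x y := le_iff_exists.2 ⟨(x + y) * z + x, by rw [npair]; nth_rw 2 [hz]; ring⟩

/-! ### Codes of finite sets and strings -/

/-- `s` codes a string of length `l`. -/
def HasLen (s l : M.N) : Prop := ∃ m n, s = npair l (npair m n)

/-- `s` codes a string whose bit `i` is `1`. Codes are also read as finite sets. -/
def Bit (s i : M.N) : Prop := ∃ l m n, s = npair l (npair m n) ∧ i < l ∧ m * (i + 1) + 1 ∣ n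

/-- `s` and `t` have the same bits below `l`. -/
def Agree (l s t : M.N) : Prop := ∀ i, i < l → (Bit s i ↔ Bit t i)

/-- `s` and `t` code the same string. -/
def Same (s t : M.N) : Prop := ∃ l, HasLen s l ∧ HasLen t l ∧ Agree l s t

/-- `s` is the least code of a string. -/
def IsStr (s : M.N) : Prop := (∃ l, HasLen s l) ∧ ∀ u, u < s → ¬ Same u s

/-- `s` codes an initial segment of the set `X`. -/
def Restr (s : M.N) (X : M.S) : Prop := ∃ l, HasLen s l ∧ ∀ i, i < l → (Bit s i ↔ i ∈ X)

/-- `s` codes a proper initial segment of the string coded by `t`. -/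
def SubLt (s t : M.N) : Prop := ∃ l k, HasLen s l ∧ HasLen t k ∧ l < k ∧ Agree l s t

/-- `s` and `t` are strings, and `s` is an initial segment of `t`. -/
def SubLe (s t : M.N) : Prop :=
  IsStr s ∧ IsStr t ∧ ∃ l k, HasLen s l ∧ HasLen t k ∧ l < k + 1 ∧ Agree l s t

theorem HasLen.unique {s l k : M.N} (h : HasLen s l) (h' : HasLen s k) : l = k := by
  obtain ⟨m, n, rfl⟩ := h
  obtain ⟨m', n', h'⟩ := h'
  exact (npair_injective h').1

theorem HasLen.le {s l : M.N} (h : HasLen s l) : l ≤ s := by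
  obtain ⟨m, n, rfl⟩ := h
  exact left_le_npair _ _

theorem Bit.lt_len {s l i : M.N} (h : Bit s i) (hs : HasLen s l) : i < l := by
  obtain ⟨k, m, n, rfl, hi, -⟩ := h
  obtain ⟨m', n', h'⟩ := hs
  rwa [← (npair_injective h').1]

theorem Bit.hasLen {s i : M.N} (h : Bit s i) : ∃ l, HasLen s l := by
  obtain ⟨k, m, n, rfl, -⟩ := h
  exact ⟨k, m, n, rfl⟩

theorem Bit.lt {s i : M.N} (h : Bit s i) : i < s := by
  obtain ⟨l, hl⟩ := h.hasLen
  exact (h.lt_len hl).trans_le hl.le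

/-- The existential quantifiers of the definition can be bounded by the code, as the components of
a pair are at most the pair. -/
theorem hasLen_iff {s l : M.N} :
    HasLen s l ↔ ∃ m, m < s + 1 ∧ ∃ n, n < s + 1 ∧ s = npair l (npair m n) := by
  refine ⟨?_, fun ⟨m, _, n, _, h⟩ => ⟨m, n, h⟩⟩
  rintro ⟨m, n, rfl⟩
  exact ⟨m, lt_add_one_iff.2 ((left_le_npair m n).trans (right_le_npair _ _)),
    n, lt_add_one_iff.2 ((right_le_npair m n).trans (right_le_npair _ _)), rfl⟩

theorem bit_iff {s i : M.N} : Bit s i ↔ ∃ l, l < s + 1 ∧ ∃ m, m < s + 1 ∧ ∃ n, n < s + 1 ∧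
    (s = npair l (npair m n) ∧ i < l ∧ m * (i + 1) + 1 ∣ n) := by
  refine ⟨?_, fun ⟨l, _, m, _, n, _, h⟩ => ⟨l, m, n, h⟩⟩
  rintro ⟨l, m, n, rfl, h⟩
  exact ⟨l, lt_add_one_iff.2 (left_le_npair _ _),
    m, lt_add_one_iff.2 ((left_le_npair m n).trans (right_le_npair _ _)),
    n, lt_add_one_iff.2 ((right_le_npair m n).trans (right_le_npair _ _)), rfl, h⟩

section

variable {f g h : (ℕ → M.N) → M.N} [IsTm f] [IsTm g] [IsTm h]

instance : D0 fun v => HasLen (f v) (g v) := by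
  simp only [hasLen_iff]
  infer_instance

instance : D0 fun v => Bit (f v) (g v) := by
  simp only [bit_iff]
  infer_instance

instance : D0 fun v => Agree (f v) (g v) (h v) := by
  unfold Agree
  infer_instance

instance : D0 fun v => Same (f v) (g v) :=
  D0.congr (P := fun v => ∃ l, l < f v + 1 ∧ HasLen (f v) l ∧ HasLen (g v) l ∧ Agree l (f v) (g v))
    (fun _ => ⟨fun ⟨l, _, h⟩ => ⟨l, h⟩, fun ⟨l, h⟩ => ⟨l, lt_add_one_iff.2 h.1.le, h⟩⟩) inferInstance

instance : D0 fun v => IsStr (f v) :=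
  D0.congr (P := fun v => (∃ l, l < f v + 1 ∧ HasLen (f v) l) ∧ ∀ u, u < f v → ¬ Same u (f v))
    (fun _ => and_congr_left' ⟨fun ⟨l, _, h⟩ => ⟨l, h⟩, fun ⟨l, h⟩ => ⟨l, lt_add_one_iff.2 h.le, h⟩⟩)
    inferInstance

instance {X : M.S} : D0 fun v => Restr (f v) X :=
  D0.congr (P := fun v => ∃ l, l < f v + 1 ∧ HasLen (f v) l ∧ ∀ i, i < l → (Bit (f v) i ↔ i ∈ X))
    (fun _ => ⟨fun ⟨l, _, h⟩ => ⟨l, h⟩, fun ⟨l, h⟩ => ⟨l, lt_add_one_iff.2 h.1.le, h⟩⟩) inferInstance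

instance : D0 fun v => SubLt (f v) (g v) :=
  D0.congr (P := fun v => ∃ l, l < f v + 1 ∧ ∃ k, k < g v + 1 ∧
      (HasLen (f v) l ∧ HasLen (g v) k ∧ l < k ∧ Agree l (f v) (g v)))
    (fun _ => ⟨fun ⟨l, _, k, _, h⟩ => ⟨l, k, h⟩, fun ⟨l, k, h⟩ =>
      ⟨l, lt_add_one_iff.2 h.1.le, k, lt_add_one_iff.2 h.2.1.le, h⟩⟩) inferInstance

end

theorem exists_code (X : M.S) (l : M.N) : ∃ s, HasLen s l ∧ ∀ i, i < l → (Bit s i ↔ i ∈ X) := by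
  obtain ⟨m, n, h⟩ := exists_beta X l
  refine ⟨npair l (npair m n), ⟨m, n, rfl⟩, fun i hi => (Iff.trans ?_ (h i hi))⟩
  refine ⟨?_, fun h => ⟨l, m, n, rfl, hi, h⟩⟩
  rintro ⟨l', m', n', h', -, hd⟩
  obtain ⟨-, h'⟩ := npair_injective h'
  obtain ⟨rfl, rfl⟩ := npair_injective h'
  exact hd

/-- Every initial segment of a set is a string in the sense of the language, that is, it has a
least code. -/
theorem exists_str (X : M.S) (l : M.N) :
    ∃ s, IsStr s ∧ HasLen s l ∧ ∀ i, i < l → (Bit s i ↔ i ∈ X) := by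
  obtain ⟨s₀, hs₀⟩ := exists_code X l
  obtain ⟨s, hs, hmin⟩ := exists_least
    (P := fun s => HasLen s l ∧ ∀ i, i < l → (Bit s i ↔ i ∈ X)) (fun f => inferInstance) hs₀
  refine ⟨s, ⟨⟨l, hs.1⟩, fun u hu ⟨k, huk, hsk, h⟩ => hmin u hu ?_⟩, hs⟩
  obtain rfl := hs.1.unique hsk
  exact ⟨huk, fun i hi => (h i hi).trans (hs.2 i hi)⟩

theorem IsStr.eq_of_same {s t : M.N} (hs : IsStr s) (ht : IsStr t) (h : Same s t) : s = t := by
  obtain ⟨l, h₁, h₂, h₃⟩ := h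
  rcases lt_trichotomy s t with hst | hst | hst
  · exact (ht.2 s hst ⟨l, h₁, h₂, h₃⟩).elim
  · exact hst
  · exact (hs.2 t hst ⟨l, h₂, h₁, fun i hi => (h₃ i hi).symm⟩).elim

/-! ### Recursive choice -/

section Recursion

variable (R : M.N → M.N → M.N → Prop) (x₀ : M.N)

/-- `y` is the least number related to `x` at stage `k`. -/
def Step (k x y : M.N) : Prop := R k x y ∧ ∀ z, z < y → ¬ R k x z

/-- `H` codes a finite set of pairs in which each pair `(i, y)` is justified: it is `(0, x₀)`, or
a pair `(i - 1, x)` with `Step R (i - 1) x y` is also present. -/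
def Justified (H : M.N) : Prop :=
  ∀ p, p < H → Bit H p → p = npair 0 x₀ ∨
    ∃ i, i < H ∧ ∃ x, x < H ∧ ∃ y, y < H ∧
      (p = npair (i + 1) y ∧ Bit H (npair i x) ∧ Step R i x y)

variable {R x₀}

theorem Step.unique {k x y z : M.N} (h : Step R k x y) (h' : Step R k x z) : y = z := by
  rcases lt_trichotomy y z with hyz | hyz | hyz
  · exact (h'.2 y hyz h.1).elim
  · exact hyz
  · exact (h.2 z hyz h'.1).elim

theorem Justified.zero {H y : M.N} (h : Justified R x₀ H) (hy : Bit H (npair 0 y)) : y = x₀ := by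
  rcases h _ hy.lt hy with h | ⟨i, -, x, -, z, -, h, -⟩
  · exact (npair_injective h).2
  · exact (succ_ne_zero i (npair_injective h).1.symm).elim

theorem Justified.succ {H i y : M.N} (h : Justified R x₀ H) (hy : Bit H (npair (i + 1) y)) :
    ∃ x, Bit H (npair i x) ∧ Step R i x y := by
  rcases h _ hy.lt hy with h | ⟨j, -, x, -, z, -, h, hx, hs⟩
  · exact (succ_ne_zero i (npair_injective h).1).elim
  · obtain ⟨h₁, rfl⟩ := npair_injective h
    obtain rfl := succ_inj h₁
    exact ⟨x, hx, hs⟩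

theorem justified_intro {H : M.N} (h : ∀ p, Bit H p → p = npair 0 x₀ ∨
    ∃ i x y, p = npair (i + 1) y ∧ Bit H (npair i x) ∧ Step R i x y) : Justified R x₀ H := by
  intro p _ hp
  rcases h p hp with h | ⟨i, x, y, rfl, hx, hs⟩
  · exact Or.inl h
  · exact Or.inr ⟨i, (left_le_npair i x).trans_lt hx.lt, x, (right_le_npair i x).trans_lt hx.lt,
      y, (right_le_npair (i + 1) y).trans_lt hp.lt, rfl, hx, hs⟩

theorem Justified.unique {H K : M.N} (h : Justified R x₀ H) (h' : Justified R x₀ K) {k y z : M.N}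
    (hy : Bit H (npair k y)) (hz : Bit K (npair k z)) : y = z := by
  refine bounded_induction (P := fun k : M.N => ∀ y, y < H → ∀ z, z < K →
    Bit H (npair k y) → Bit K (npair k z) → y = z) ?_ ?_ k y
    ((right_le_npair k y).trans_lt hy.lt) z ((right_le_npair k z).trans_lt hz.lt) hy hz
  · intro y _ z _ hy hz
    rw [h.zero hy, h'.zero hz]
  · intro k ih y _ z _ hy hz
    obtain ⟨u, hu, hs⟩ := h.succ hy
    obtain ⟨v, hv, hs'⟩ := h'.succ hz
    obtain rfl := ih u ((right_le_npair k u).trans_lt hu.lt) v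
      ((right_le_npair k v).trans_lt hv.lt) hu hv
    exact hs.unique hs'

/-- The finite set with one more element. -/
theorem exists_insert (H p : M.N) : ∃ K, ∀ q, Bit K q ↔ Bit H q ∨ q = p := by
  obtain ⟨X, hX⟩ := bounded_comprehension fun q : M.N => Bit H q ∨ q = p
  obtain ⟨K, hK, hKX⟩ := exists_code X (H + p + 1)
  refine ⟨K, fun q => ⟨fun h => (hX q).1 ((hKX q (h.lt_len hK)).1 h), fun h => ?_⟩⟩
  refine (hKX q (lt_add_one_iff.2 ?_)).2 ((hX q).2 h)
  rcases h with h | rfl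
  · exact h.lt.le.trans le_self_add
  · exact le_add_self

theorem not_bit_zero_code (x : M.N) : ¬ Bit (npair 0 (npair 0 0)) x := by
  intro h
  exact not_lt_zero' _ (h.lt_len ⟨0, 0, rfl⟩)

/-- Dependent choice of least values: if `R` is `Σ⁰₀` and always applicable on the class `A`,
in which it takes its values, there is a set that is the graph of a sequence starting with `x₀`
whose consecutive values are related by `R`. -/
theorem exists_sequence (hR : ∀ (f g h : (ℕ → M.N) → M.N) [IsTm f] [IsTm g] [IsTm h],
      D0 fun v => R (f v) (g v) (h v))
    {A : M.N → Prop} (hx₀ : A x₀) (hex : ∀ k x, A x → ∃ y, R k x y)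
    (hA : ∀ k x y, R k x y → A y) :
    ∃ G : M.S, npair 0 x₀ ∈ G ∧ (∀ k, ∃ x, npair k x ∈ G) ∧
      (∀ k x y, npair k x ∈ G → npair k y ∈ G → x = y) ∧
      ∀ k x y, npair k x ∈ G → npair (k + 1) y ∈ G → R k x y := by
  have hStep : ∀ (f g h : (ℕ → M.N) → M.N) [IsTm f] [IsTm g] [IsTm h],
      D0 fun v => Step R (f v) (g v) (h v) := by
    intro f g h _ _ _
    unfold Step
    infer_instance
  have hJ : ∀ (f : (ℕ → M.N) → M.N) [IsTm f], D0 fun v => Justified R x₀ (f v) := by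
    intro f _
    unfold Justified
    infer_instance
  -- Induction yields a justified set with an element at each stage.
  have total : ∀ k, ∃ H, Justified R x₀ H ∧ ∃ y, y < H ∧ Bit H (npair k y) := by
    refine fun k => sigma_induction
      (P := fun H k : M.N => Justified R x₀ H ∧ ∃ y, y < H ∧ Bit H (npair k y)) ?_ ?_ k
    · obtain ⟨H, hH⟩ := exists_insert (npair 0 (npair 0 0)) (npair 0 x₀)
      have h0 : Bit H (npair 0 x₀) := (hH _).2 (Or.inr rfl)
      refine ⟨H, justified_intro fun p hp => Or.inl (((hH p).1 hp).resolve_left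
        (not_bit_zero_code p)), x₀, (right_le_npair _ _).trans_lt h0.lt, h0⟩
    · rintro k ⟨H, hJH, y, -, hy⟩
      have hAy : A y := by
        rcases eq_zero_or_succ k with rfl | ⟨k, rfl⟩
        · rwa [hJH.zero hy]
        · obtain ⟨x, -, hs⟩ := hJH.succ hy
          exact hA _ _ _ hs.1
      obtain ⟨z₀, hz₀⟩ := hex k y hAy
      obtain ⟨z, hz⟩ : ∃ z, Step R k y z :=
        exists_least (P := fun z => R k y z) (fun f => inferInstance) hz₀
      obtain ⟨K, hK⟩ := exists_insert H (npair (k + 1) z)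
      have hzK : Bit K (npair (k + 1) z) := (hK _).2 (Or.inr rfl)
      refine ⟨K, justified_intro fun p hp => ?_, z, (right_le_npair _ _).trans_lt hzK.lt, hzK⟩
      rcases (hK p).1 hp with hp | rfl
      · rcases hJH p hp.lt hp with h | ⟨i, -, x, -, w, -, h, hx, hs⟩
        · exact Or.inl h
        · exact Or.inr ⟨i, x, w, h, (hK _).2 (Or.inl hx), hs⟩
      · exact Or.inr ⟨k, y, z, rfl, (hK _).2 (Or.inl hy), hz⟩
  -- The graph is `Σ⁰₁`, and `Π⁰₁` because the sequence is total and single-valued.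
  obtain ⟨G, hG⟩ := delta_comprehension
    (P := fun H p : M.N => Justified R x₀ H ∧ Bit H p ∧
      ∃ k, k < p + 1 ∧ ∃ x, x < p + 1 ∧ p = npair k x)
    (Q := fun H p : M.N => (∃ k, k < p + 1 ∧ ∃ x, x < p + 1 ∧ p = npair k x) ∧
      ∀ k, k < p + 1 → ∀ x, x < p + 1 → ∀ y, y < H →
        (p = npair k x → Justified R x₀ H → Bit H (npair k y) → y = x)) (by
    intro p
    constructor
    · rintro ⟨H, hJH, hp, hkx⟩ K
      refine ⟨hkx, fun k _ x _ y _ hpk hJK hy => ?_⟩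
      subst hpk
      exact hJK.unique hJH hy hp
    · intro h
      obtain ⟨k, hk, x, hx, rfl⟩ := (h 0).1
      obtain ⟨H, hJH, y, hyH, hy⟩ := total k
      obtain rfl := (h H).2 k hk x hx y hyH rfl hJH hy
      exact ⟨H, hJH, hy, k, hk, y, hx, rfl⟩)
  have hG' : ∀ k x, npair k x ∈ G ↔ ∃ H, Justified R x₀ H ∧ Bit H (npair k x) := by
    refine fun k x => (hG _).trans (exists_congr fun H => and_congr_right fun _ => ?_)
    exact and_iff_left ⟨k, lt_add_one_iff.2 (left_le_npair _ _), x,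
      lt_add_one_iff.2 (right_le_npair _ _), rfl⟩
  refine ⟨G, ?_, fun k => ?_, fun k x y hx hy => ?_, fun k x y hx hy => ?_⟩
  · obtain ⟨H, hJH, y, -, hy⟩ := total 0
    obtain rfl := hJH.zero hy
    exact (hG' _ _).2 ⟨H, hJH, hy⟩
  · obtain ⟨H, hJH, y, -, hy⟩ := total k
    exact ⟨y, (hG' _ _).2 ⟨H, hJH, hy⟩⟩
  · obtain ⟨H, hJH, hx⟩ := (hG' _ _).1 hx
    obtain ⟨K, hJK, hy⟩ := (hG' _ _).1 hy
    exact hJH.unique hJK hx hy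
  · obtain ⟨H, hJH, hx⟩ := (hG' _ _).1 hx
    obtain ⟨K, hJK, hy⟩ := (hG' _ _).1 hy
    obtain ⟨u, hu, hs⟩ := hJK.succ hy
    obtain rfl := hJH.unique hJK hx hu
    exact hs.1

end Recursion

/-! ### Limits of increasing sequences of strings -/

/-- From each string in the class `A` one can pass, at every stage `k`, to a proper extension `t`
in `A` with a number `w` such that `P k t w`. Then some set extends a given `s₀` in `A`, and at
every stage it extends such a `t` of length above `k`. -/
theorem exists_limit {P : M.N → M.N → M.N → Prop}
    (hP : ∀ (f g h : (ℕ → M.N) → M.N) [IsTm f] [IsTm g] [IsTm h], D0 fun v => P (f v) (g v) (h v))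
    {A : M.N → Prop} {s₀ : M.N} (hs₀ : A s₀) (hlen : ∃ l, HasLen s₀ l)
    (hex : ∀ k s, A s → ∃ t w, SubLt s t ∧ P k t w) (hA : ∀ k t w, P k t w → A t) :
    ∃ X : M.S, Restr s₀ X ∧ ∀ k, ∃ t w l, P k t w ∧ Restr t X ∧ HasLen t l ∧ k < l := by
  obtain ⟨G, h0, htot, huniq, hstep⟩ := exists_sequence (x₀ := npair s₀ 0)
    (R := fun k x y : M.N => ∃ s, s < x + 1 ∧ ∃ a, a < x + 1 ∧ ∃ t, t < y + 1 ∧ ∃ w, w < y + 1 ∧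
      (x = npair s a ∧ y = npair t w ∧ SubLt s t ∧ P k t w))
    (fun f g h => inferInstance) (A := fun x => ∃ s a, x = npair s a ∧ A s) ⟨s₀, 0, rfl, hs₀⟩
    (by
      rintro k x ⟨s, a, rfl, hs⟩
      obtain ⟨t, w, hst, hPt⟩ := hex k s hs
      exact ⟨npair t w, s, lt_add_one_iff.2 (left_le_npair _ _), a,
        lt_add_one_iff.2 (right_le_npair _ _), t, lt_add_one_iff.2 (left_le_npair _ _), w,
        lt_add_one_iff.2 (right_le_npair _ _), rfl, rfl, hst, hPt⟩)
    (by
      rintro k x y ⟨s, -, a, -, t, -, w, -, -, rfl, -, h⟩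
      exact ⟨t, w, rfl, hA _ _ _ h⟩)
  -- `S k s` says that `s` is the string chosen at stage `k`.
  let S : M.N → M.N → Prop := fun k s => ∃ a, npair k (npair s a) ∈ G
  have hS0 : S 0 s₀ := ⟨0, h0⟩
  have hSuniq : ∀ {k s t}, S k s → S k t → s = t := by
    rintro k s t ⟨a, ha⟩ ⟨b, hb⟩
    exact (npair_injective (huniq _ _ _ ha hb)).1
  have hSsucc : ∀ {k}, (∃ s, S k s) → ∃ t w, npair (k + 1) (npair t w) ∈ G ∧ P k t w ∧
      ∀ s, S k s → SubLt s t := by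
    rintro k ⟨s, a, ha⟩
    obtain ⟨y, hy⟩ := htot (k + 1)
    obtain ⟨s', -, a', -, t, -, w, -, h₁, rfl, hlt, hPt⟩ := hstep _ _ _ ha hy
    refine ⟨t, w, hy, hPt, fun u hu => ?_⟩
    rw [hSuniq hu ⟨a, ha⟩, (npair_injective h₁).1]
    exact hlt
  have hStot : ∀ k, ∃ s, S k s := by
    intro k
    rcases eq_zero_or_succ k with rfl | ⟨k, rfl⟩
    · exact ⟨s₀, hS0⟩
    · obtain ⟨x, hx⟩ := htot k
      obtain ⟨y, hy⟩ := htot (k + 1)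
      obtain ⟨s, -, a, -, t, -, w, -, rfl, rfl, -⟩ := hstep _ _ _ hx hy
      exact ⟨t, w, hy⟩
  have hSlen : ∀ k, ∃ p, ∃ s, s < p + 1 ∧ ∃ a, a < p + 1 ∧ ∃ l, l < s + 1 ∧
      (p = npair s a ∧ npair k p ∈ G ∧ HasLen s l ∧ k < l + 1) := by
    refine fun k => sigma_induction (P := fun p k : M.N => ∃ s, s < p + 1 ∧ ∃ a, a < p + 1 ∧
      ∃ l, l < s + 1 ∧ (p = npair s a ∧ npair k p ∈ G ∧ HasLen s l ∧ k < l + 1)) ?_ ?_ k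
    · obtain ⟨l, hl⟩ := hlen
      exact ⟨npair s₀ 0, s₀, lt_add_one_iff.2 (left_le_npair _ _), 0,
        lt_add_one_iff.2 (right_le_npair _ _), l, lt_add_one_iff.2 hl.le, rfl, h0, hl,
        lt_add_one_iff.2 zero_le⟩
    · rintro k ⟨p, s, -, a, -, l, -, rfl, hp, hl, hkl⟩
      obtain ⟨t, w, ht, -, hlt⟩ := hSsucc ⟨s, a, hp⟩
      obtain ⟨l', m, hl', hm, hlm, -⟩ := hlt s ⟨a, hp⟩
      obtain rfl := hl.unique hl'
      exact ⟨npair t w, t, lt_add_one_iff.2 (left_le_npair _ _), w,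
        lt_add_one_iff.2 (right_le_npair _ _), m, lt_add_one_iff.2 hm.le, rfl, ht, hm,
        lt_add_one_iff.2 ((lt_add_one_iff.1 hkl).trans_lt hlm |> add_one_le_iff.2)⟩
  have hSlen' : ∀ {k s}, S k s → ∃ l, HasLen s l ∧ k ≤ l := by
    intro k s hs
    obtain ⟨p, t, -, a, -, l, -, rfl, hp, hl, hkl⟩ := hSlen k
    obtain rfl := hSuniq hs ⟨a, hp⟩
    exact ⟨l, hl, lt_add_one_iff.1 hkl⟩
  have hSagree : ∀ {k s l}, S k s → HasLen s l → ∀ j t, S (k + j) t → Agree l s t ∧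
      ∃ m, HasLen t m ∧ l ≤ m := by
    intro k s l hs hl j t ht
    obtain ⟨p, u, -, a, -, m, -, rfl, hp, hm, hlm, hag⟩ := sigma_induction
      (P := fun p j : M.N => ∃ u, u < p + 1 ∧ ∃ a, a < p + 1 ∧ ∃ m, m < u + 1 ∧
        (p = npair u a ∧ npair (k + j) p ∈ G ∧ HasLen u m ∧ l < m + 1 ∧ Agree l s u)) (by
        obtain ⟨a, ha⟩ := hs
        refine ⟨npair s a, s, lt_add_one_iff.2 (left_le_npair _ _), a,
          lt_add_one_iff.2 (right_le_npair _ _), l, lt_add_one_iff.2 hl.le, rfl, ?_, hl,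
          lt_add_one_iff.2 le_rfl, fun i _ => Iff.rfl⟩
        rwa [add_zero]) (by
        rintro j ⟨p, u, -, a, -, m, -, rfl, hp, hm, hlm, hag⟩
        obtain ⟨t, w, ht, -, hlt⟩ := hSsucc ⟨u, a, hp⟩
        obtain ⟨m', n, hm', hn, hmn, hag'⟩ := hlt u ⟨a, hp⟩
        obtain rfl := hm.unique hm'
        refine ⟨npair t w, t, lt_add_one_iff.2 (left_le_npair _ _), w,
          lt_add_one_iff.2 (right_le_npair _ _), n, lt_add_one_iff.2 hn.le, rfl, ?_, hn,
          lt_add_one_iff.2 ((lt_add_one_iff.1 hlm).trans hmn.le), fun i hi => ?_⟩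
        · rwa [← add_assoc]
        · exact (hag i hi).trans (hag' i (hi.trans_le (lt_add_one_iff.1 hlm)))) j
    obtain rfl := hSuniq ht ⟨a, hp⟩
    exact ⟨hag, m, hm, lt_add_one_iff.1 hlm⟩
  have hcomp : ∀ {k k' s s' i}, S k s → S k' s' → (∀ l, HasLen s l → i < l) →
      (∀ l, HasLen s' l → i < l) → (Bit s i ↔ Bit s' i) := by
    have aux : ∀ {k k' s s' i}, k ≤ k' → S k s → S k' s' → (∀ l, HasLen s l → i < l) →
        (Bit s i ↔ Bit s' i) := by
      intro k k' s s' i hk hs hs' hi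
      obtain ⟨j, rfl⟩ := le_iff_exists.1 hk
      obtain ⟨l, hl, -⟩ := hSlen' hs
      exact (hSagree hs hl j s' hs').1 i (hi l hl)
    intro k k' s s' i hs hs' hi hi'
    rcases le_total k k' with h | h
    · exact aux h hs hs' hi
    · exact (aux h hs' hs hi').symm
  -- Bit `i` of the limit is decided by the string chosen at stage `i + 1`.
  obtain ⟨X, hX⟩ := delta_comprehension
    (P := fun p i : M.N => npair (i + 1) p ∈ G ∧
      ∃ s, s < p + 1 ∧ ∃ a, a < p + 1 ∧ (p = npair s a ∧ Bit s i))
    (Q := fun p i : M.N => npair (i + 1) p ∈ G →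
      ∃ s, s < p + 1 ∧ ∃ a, a < p + 1 ∧ (p = npair s a ∧ Bit s i)) (by
    intro i
    constructor
    · rintro ⟨p, hp, h⟩ q hq
      rwa [huniq _ _ _ hq hp]
    · intro h
      obtain ⟨p, hp⟩ := htot (i + 1)
      exact ⟨p, hp, h p hp⟩)
  have hSX : ∀ {k s}, S k s → Restr s X := by
    intro k s hs
    obtain ⟨l, hl, -⟩ := hSlen' hs
    refine ⟨l, hl, fun i hi => ?_⟩
    obtain ⟨t, a, hta⟩ := hStot (i + 1)
    have hst : Bit s i ↔ Bit t i := by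
      refine hcomp hs ⟨a, hta⟩ (fun m hm => hl.unique hm ▸ hi) fun m hm => ?_
      obtain ⟨m', hm', him⟩ := hSlen' ⟨a, hta⟩
      rw [hm.unique hm']
      exact add_one_le_iff.1 him
    rw [hst, hX]
    constructor
    · exact fun h => ⟨npair t a, hta, t, lt_add_one_iff.2 (left_le_npair _ _), a,
        lt_add_one_iff.2 (right_le_npair _ _), rfl, h⟩
    · rintro ⟨p, hp, u, -, b, -, rfl, hu⟩
      rwa [hSuniq ⟨a, hta⟩ ⟨b, hp⟩]
  refine ⟨X, hSX hS0, fun k => ?_⟩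
  obtain ⟨t, w, ht, hPt, -⟩ := hSsucc (hStot k)
  obtain ⟨l, hl, hkl⟩ := hSlen' ⟨w, ht⟩
  exact ⟨t, w, l, hPt, hSX ⟨w, ht⟩, hl, add_one_le_iff.1 hkl⟩

/-! ### Closed and open classes in a model -/

/-- `X` extends the string `s`. -/
def Cyl (s : M.N) (X : M.S) : Prop := IsStr s ∧ Restr s X

/-- The members of `T` are strings, and initial segments of members are members. -/
def IsTree (T : M.S) : Prop :=
  (∀ s, s ∈ T → IsStr s) ∧ ∀ s, s ∈ T → ∀ t, SubLe t s → t ∈ T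

/-- `X` is a path through `T`. -/
def Path (X T : M.S) : Prop := ∀ n, ∃ s, Cyl s X ∧ HasLen s n ∧ s ∈ T

/-- `X` lies in the separably closed set with code `(e, S)`. -/
def SepMem (e : M.N) (S X : M.S) : Prop :=
  e ≠ 0 ∧ ∀ k, ∃ n, ∀ i, i < k → (npair n i ∈ S ↔ i ∈ X)

/-- `V` codes a sequence of nonempty open sets. -/
def IsOpenSeq (V : M.S) : Prop :=
  ∀ n, (∀ s, npair n s ∈ V → IsStr s) ∧ ∃ s, npair n s ∈ V

/-- `X` lies in the open set with index `n` in the sequence coded by `V`. -/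
def OpenMem (n : M.N) (V X : M.S) : Prop := ∃ s, npair n s ∈ V ∧ Cyl s X

/-- The class `B` is dense in the class `F`. -/
def DenseIn (F B : M.S → Prop) : Prop :=
  ∀ s, IsStr s → (∃ X, Cyl s X ∧ F X) → ∃ X, Cyl s X ∧ F X ∧ B X

theorem SubLt.of_restr {s t l k : M.N} {X : M.S} (hs : Restr s X) (ht : Restr t X)
    (hl : HasLen s l) (hk : HasLen t k) (hlk : l < k) : SubLt s t := by
  obtain ⟨l', hl', hs⟩ := hs
  obtain ⟨k', hk', ht⟩ := ht
  obtain rfl := hl.unique hl'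
  obtain rfl := hk.unique hk'
  exact ⟨l, k, hl, hk, hlk, fun i hi => (hs i hi).trans (ht i (hi.trans hlk)).symm⟩

theorem Restr.of_subLt {s t : M.N} {X : M.S} (ht : Restr t X) (h : SubLt s t) : Restr s X := by
  obtain ⟨k', hk', ht⟩ := ht
  obtain ⟨l, k, hl, hk, hlk, hst⟩ := h
  obtain rfl := hk.unique hk'
  exact ⟨l, hl, fun i hi => (hst i hi).trans (ht i (hi.trans hlk))⟩

/-! ### The Baire Category Theorem in a model -/

/-- The initial segments of a set that extends arbitrarily long members of a tree are in the
tree. -/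
theorem IsTree.path {T X : M.S} (hT : IsTree T)
    (h : ∀ k, ∃ t l, t ∈ T ∧ Restr t X ∧ HasLen t l ∧ k < l) : Path X T := by
  intro k
  obtain ⟨t, l, htT, ⟨l', hl', ht⟩, hl, hkl⟩ := h k
  obtain rfl := hl.unique hl'
  obtain ⟨s, hs, hsk, hsX⟩ := exists_str X k
  refine ⟨s, ⟨hs, k, hsk, hsX⟩, hsk, hT.2 t htT s ⟨hs, hT.1 t htT, k, l, hsk, hl,
    lt_add_one_iff.2 hkl.le, fun i hi => (hsX i hi).trans (ht i (hi.trans hkl)).symm⟩⟩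

/-- Every member of a pruned tree is extended by a path. -/
theorem IsTree.exists_path {T : M.S} (hT : IsTree T) (hpr : ∀ s, s ∈ T → ∃ t, t ∈ T ∧ SubLt s t)
    {s : M.N} (hs : s ∈ T) : ∃ X, Cyl s X ∧ Path X T := by
  obtain ⟨X, hsX, hX⟩ := exists_limit (P := fun _ t _ => t ∈ T) (fun f g h => inferInstance)
    (A := fun t => t ∈ T) hs (hT.1 s hs).1
    (fun k s hs => by
      obtain ⟨t, ht, hst⟩ := hpr s hs
      exact ⟨t, 0, hst, ht⟩)
    fun _ _ _ h => h
  refine ⟨X, ⟨hT.1 s hs, hsX⟩, hT.path fun k => ?_⟩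
  obtain ⟨t, w, l, h⟩ := hX k
  exact ⟨t, l, h⟩

theorem Path.mem_of_cyl {X T : M.S} {s : M.N} (hX : Path X T) (hs : Cyl s X) : s ∈ T := by
  obtain ⟨hstr, l, hl, hs⟩ := hs
  obtain ⟨t, ⟨htstr, l', hl', ht⟩, htl, htT⟩ := hX l
  obtain rfl := htl.unique hl'
  rwa [hstr.eq_of_same htstr ⟨l, hl, htl, fun i hi => (hs i hi).trans (ht i hi).symm⟩]

/-- The Baire Category Theorem for the paths through a pruned tree, in a model. -/
theorem baire_pruned {T V : M.S} (hT : IsTree T)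
    (hpr : ∀ s, s ∈ T → ∃ t, t ∈ T ∧ SubLt s t) (hV : IsOpenSeq V)
    (hd : ∀ n, DenseIn (fun X => Path X T) (OpenMem n V)) :
    DenseIn (fun X => Path X T) fun X => ∀ n, OpenMem n V X := by
  rintro s₀ hs₀ ⟨X₀, hX₀, hpath⟩
  obtain ⟨X, hsX, hX⟩ := exists_limit
    (P := fun k t w => t ∈ T ∧ npair k w ∈ V ∧ SubLt w t) (fun f g h => inferInstance)
    (A := fun t => t ∈ T) (hpath.mem_of_cyl hX₀) hs₀.1
    (by
      intro k s hs
      obtain ⟨X, ⟨-, hsX⟩, hX, w, hw, -, hwX⟩ := hd k s (hT.1 s hs) (hT.exists_path hpr hs)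
      obtain ⟨l, hl, -⟩ := id hsX
      obtain ⟨m, hm, -⟩ := id hwX
      obtain ⟨t, ⟨-, htX⟩, ht, htT⟩ := hX (l + m + 1)
      exact ⟨t, w, .of_restr hsX htX hl ht (lt_add_one_iff.2 le_self_add), htT, hw,
        .of_restr hwX htX hm ht (lt_add_one_iff.2 le_add_self)⟩)
    fun _ _ _ h => h.1
  refine ⟨X, ⟨hs₀, hsX⟩, hT.path fun k => ?_, fun k => ?_⟩
  · obtain ⟨t, w, l, h, h'⟩ := hX k
    exact ⟨t, l, h.1, h'⟩
  · obtain ⟨t, w, l, ⟨-, hw, hwt⟩, htX, -⟩ := hX k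
    exact ⟨w, hw, (hV k).1 w hw, htX.of_subLt hwt⟩

/-- The Baire Category Theorem for separably closed sets, in a model. -/
theorem baire_separable {e : M.N} {S V : M.S} (hV : IsOpenSeq V)
    (hd : ∀ n, DenseIn (SepMem e S) (OpenMem n V)) :
    DenseIn (SepMem e S) fun X => ∀ n, OpenMem n V X := by
  rintro s₀ hs₀ ⟨X₀, ⟨-, l₀, hl₀, hX₀⟩, he, hsep⟩
  obtain ⟨n₀, hn₀⟩ := hsep l₀
  -- The witness `w` is a pair: the index of a member of the sequence `S` that extends `t`, and
  -- a string in the code of the open set that `t` extends.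
  obtain ⟨X, hsX, hX⟩ := exists_limit
    (P := fun k t w => IsStr t ∧ ∃ n, n < w + 1 ∧ ∃ u, u < w + 1 ∧ ∃ l, l < t + 1 ∧
      (w = npair n u ∧ HasLen t l ∧ (∀ i, i < l → (Bit t i ↔ npair n i ∈ S)) ∧
        npair k u ∈ V ∧ SubLt u t)) (fun f g h => inferInstance)
    (A := fun t => IsStr t ∧ ∃ n l, HasLen t l ∧ ∀ i, i < l → (Bit t i ↔ npair n i ∈ S))
    ⟨hs₀, n₀, l₀, hl₀, fun i hi => (hX₀ i hi).trans (hn₀ i hi).symm⟩ hs₀.1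
    (by
      rintro k s ⟨hs, n, l, hl, hsn⟩
      obtain ⟨Y, hY⟩ := bounded_comprehension fun i : M.N => npair n i ∈ S
      obtain ⟨X, ⟨-, hsX⟩, ⟨-, hX⟩, u, hu, -, huX⟩ := hd k s hs
        ⟨Y, ⟨hs, l, hl, fun i hi => (hsn i hi).trans (hY i).symm⟩, he,
          fun _ => ⟨n, fun i _ => (hY i).symm⟩⟩
      obtain ⟨m, hm, -⟩ := id huX
      obtain ⟨t, ht, htl, htX⟩ := exists_str X (l + m + 1)
      obtain ⟨n', hn'⟩ := hX (l + m + 1)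
      have hr : Restr t X := ⟨_, htl, htX⟩
      exact ⟨t, npair n' u, .of_restr hsX hr hl htl (lt_add_one_iff.2 le_self_add), ht, n',
        lt_add_one_iff.2 (left_le_npair _ _), u, lt_add_one_iff.2 (right_le_npair _ _), _,
        lt_add_one_iff.2 htl.le, rfl, htl, fun i hi => (htX i hi).trans (hn' i hi).symm, hu,
        .of_restr huX hr hm htl (lt_add_one_iff.2 le_add_self)⟩)
    (by
      rintro k t w ⟨ht, n, -, u, -, l, -, -, hl, h, -⟩
      exact ⟨ht, n, l, hl, h⟩)
  refine ⟨X, ⟨hs₀, hsX⟩, ⟨he, fun k => ?_⟩, fun k => ?_⟩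
  · obtain ⟨t, w, l, ⟨-, n, -, u, -, l', -, -, hl', h, -⟩, ⟨l'', hl'', htX⟩, hl, hkl⟩ := hX k
    obtain rfl := hl.unique hl'
    obtain rfl := hl.unique hl''
    exact ⟨n, fun i hi => (h i (hi.trans hkl)).symm.trans (htX i (hi.trans hkl))⟩
  · obtain ⟨t, w, l, ⟨-, n, -, u, -, l', -, -, -, -, hu, hut⟩, htX, -⟩ := hX k
    exact ⟨u, hu, (hV k).1 u hu, htX.of_subLt hut⟩

/-! ### Meaning of the formulas in a model -/

section

variable (e : ℕ → M.N) (E : ℕ → M.S)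

theorem eval_pair (s t : NTerm) : (NTerm.pair s t).eval M.toStructure₂ e =
    npair (s.eval M.toStructure₂ e) (t.eval M.toStructure₂ e) := rfl

theorem sat_fDvd (a b : NTerm) : (fDvd a b).Sat M.toStructure₂ e E ↔
    a.eval M.toStructure₂ e ∣ b.eval M.toStructure₂ e := by
  simp only [fDvd, Fml.sat_bexN, Fml.sat_eq, NTerm.eval_up, NTerm.eval_add, NTerm.eval_mul,
    NTerm.eval_one, NTerm.eval_var, scons_zero]
  exact dvd_iff.symm

theorem sat_fLen (s l : NTerm) : (fLen s l).Sat M.toStructure₂ e E ↔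
    HasLen (s.eval M.toStructure₂ e) (l.eval M.toStructure₂ e) := by
  simp only [fLen, Fml.sat_exN, Fml.sat_eq, NTerm.eval_up, eval_pair, NTerm.eval_var, scons_zero,
    scons_succ, HasLen]

theorem sat_fBit (s i : NTerm) : (fBit s i).Sat M.toStructure₂ e E ↔
    Bit (s.eval M.toStructure₂ e) (i.eval M.toStructure₂ e) := by
  simp only [fBit, Fml.sat_exN, Fml.sat_and, Fml.sat_eq, Fml.sat_lt, sat_fDvd, NTerm.eval_up,
    eval_pair, NTerm.eval_var, NTerm.eval_add, NTerm.eval_mul, NTerm.eval_one, scons_zero,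
    scons_succ]
  rfl

theorem sat_fSame (s t : NTerm) : (fSame s t).Sat M.toStructure₂ e E ↔
    Same (s.eval M.toStructure₂ e) (t.eval M.toStructure₂ e) := by
  simp only [fSame, Fml.sat_exN, Fml.sat_and, Fml.sat_ballN, Fml.sat_iff, sat_fLen, sat_fBit,
    NTerm.eval_up, NTerm.eval_var, scons_zero, Same, Agree]

theorem sat_fStr (s : NTerm) : (fStr s).Sat M.toStructure₂ e E ↔
    IsStr (s.eval M.toStructure₂ e) := by
  simp only [fStr, Fml.sat_exN, Fml.sat_and, Fml.sat_ballN, Fml.sat_neg, sat_fLen, sat_fSame,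
    NTerm.eval_up, NTerm.eval_var, scons_zero, IsStr]

theorem sat_fPrefix (s t : NTerm) : (fPrefix s t).Sat M.toStructure₂ e E ↔
    SubLe (s.eval M.toStructure₂ e) (t.eval M.toStructure₂ e) := by
  simp only [fPrefix, Fml.sat_exN, Fml.sat_and, Fml.sat_ballN, Fml.sat_iff, Fml.sat_lt, sat_fLen,
    sat_fBit, sat_fStr, NTerm.eval_up, NTerm.eval_var, NTerm.eval_add, NTerm.eval_one, scons_zero,
    scons_succ]
  rfl

theorem sat_fCyl (s : NTerm) (X : ℕ) : (fCyl s X).Sat M.toStructure₂ e E ↔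
    Cyl (s.eval M.toStructure₂ e) (E X) := by
  simp only [fCyl, Fml.sat_exN, Fml.sat_and, Fml.sat_ballN, Fml.sat_iff, Fml.sat_mem, sat_fLen,
    sat_fBit, sat_fStr, NTerm.eval_up, NTerm.eval_var, scons_zero, Cyl, Restr]

theorem sat_fTree (T : ℕ) : (fTree T).Sat M.toStructure₂ e E ↔ IsTree (E T) := by
  simp only [fTree, Fml.sat_allN, Fml.sat_and, Fml.sat_imp, Fml.sat_mem, sat_fPrefix,
    sat_fStr, NTerm.eval_var, scons_zero, scons_succ, IsTree]

theorem subLt_of_fAppend {s t : M.N} {C : M.N → Prop}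
    (h : SubLe s t ∧ ∃ l, HasLen s l ∧ HasLen t (l + 1) ∧ C l) : SubLt s t := by
  obtain ⟨⟨-, -, l, k, hl, hk, -, hag⟩, m, hm, hm', -⟩ := h
  obtain rfl := hl.unique hm
  exact ⟨l, l + 1, hl, hm', lt_add_one_iff.2 le_rfl, hag⟩

theorem pruned_of_sat {T : ℕ} (h : (fPruned T).Sat M.toStructure₂ e E) :
    IsTree (E T) ∧ ∀ s, s ∈ E T → ∃ t, t ∈ E T ∧ SubLt s t := by
  simp only [fPruned, fAppend0, fAppend1, Fml.sat_and, sat_fTree, Fml.sat_allN, Fml.sat_imp,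
    Fml.sat_or, Fml.sat_exN, Fml.sat_neg, Fml.sat_mem, sat_fPrefix, sat_fLen, sat_fBit,
    NTerm.eval_up, NTerm.eval_var, NTerm.eval_add, NTerm.eval_one, scons_zero, scons_succ] at h
  refine ⟨h.1, fun s hs => ?_⟩
  rcases h.2 s hs with ⟨t, h, ht⟩ | ⟨t, h, ht⟩
  · exact ⟨t, ht, subLt_of_fAppend (C := fun l => ¬ Bit t l) h⟩
  · exact ⟨t, ht, subLt_of_fAppend (C := fun l => Bit t l) h⟩

theorem sat_fPath (X T : ℕ) : (fPath X T).Sat M.toStructure₂ e E ↔ Path (E X) (E T) := by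
  simp only [fPath, Fml.sat_allN, Fml.sat_exN, Fml.sat_and, Fml.sat_mem, sat_fCyl, sat_fLen,
    NTerm.eval_var, scons_zero, scons_succ, Path]

theorem sat_fSepMem (t : NTerm) (S X : ℕ) : (fSepMem t S X).Sat M.toStructure₂ e E ↔
    SepMem (t.eval M.toStructure₂ e) (E S) (E X) := by
  simp only [fSepMem, Fml.sat_allN, Fml.sat_exN, Fml.sat_and, Fml.sat_neg, Fml.sat_eq,
    Fml.sat_ballN, Fml.sat_iff, Fml.sat_mem, eval_pair, NTerm.eval_zero, NTerm.eval_var,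
    scons_zero, scons_succ]
  rfl

theorem sat_fOpenSeq (V : ℕ) : (fOpenSeq V).Sat M.toStructure₂ e E ↔ IsOpenSeq (E V) := by
  simp only [fOpenSeq, Fml.sat_allN, Fml.sat_exN, Fml.sat_and, Fml.sat_imp, Fml.sat_mem, sat_fStr,
    eval_pair, NTerm.eval_var, scons_zero, scons_succ, IsOpenSeq]

theorem sat_fOpenMem (n : NTerm) (V X : ℕ) : (fOpenMem n V X).Sat M.toStructure₂ e E ↔
    OpenMem (n.eval M.toStructure₂ e) (E V) (E X) := by
  simp only [fOpenMem, Fml.sat_exN, Fml.sat_and, Fml.sat_mem, sat_fCyl, eval_pair, NTerm.eval_up,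
    NTerm.eval_var, scons_zero, OpenMem]

theorem sat_fDense (F B : Fml) {F' B' : M.S → Prop}
    (hF : ∀ s X, F.Sat M.toStructure₂ (scons s e) (scons X E) ↔ F' X)
    (hB : ∀ s X, B.Sat M.toStructure₂ (scons s e) (scons X E) ↔ B' X) :
    (fDense F B).Sat M.toStructure₂ e E ↔ DenseIn F' B' := by
  simp only [fDense, Fml.sat_allN, Fml.sat_exS, Fml.sat_and, Fml.sat_imp, sat_fStr, sat_fCyl,
    NTerm.eval_var, scons_zero, hF, hB, DenseIn]

theorem sat_BCTCII : BCTCII.Sat M.toStructure₂ e E := by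
  intro x S V
  rw [Fml.sat_imp, Fml.sat_imp, sat_fOpenSeq, Fml.sat_allN]
  intro hV hd
  refine (sat_fDense _ _ _ _ (F' := SepMem x S) (B' := fun X => ∀ n, OpenMem n V X)
    (fun _ _ => sat_fSepMem _ _ _ _ _) fun _ X => ?_).2 (baire_separable hV fun n => ?_)
  · exact forall_congr' fun n => sat_fOpenMem _ _ _ _ _
  · exact (sat_fDense _ _ _ _ (F' := SepMem x S) (B' := OpenMem n V)
      (fun _ _ => sat_fSepMem _ _ _ _ _) fun _ _ => sat_fOpenMem _ _ _ _ _).1 (hd n)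

theorem sat_BCTCIII : BCTCIII.Sat M.toStructure₂ e E := by
  intro T V
  rw [Fml.sat_imp, Fml.sat_imp, Fml.sat_imp, sat_fOpenSeq, Fml.sat_allN]
  intro hT hV hd
  obtain ⟨hT, hpr⟩ := pruned_of_sat _ _ hT
  refine (sat_fDense _ _ _ _ (F' := fun X => Path X T) (B' := fun X => ∀ n, OpenMem n V X)
    (fun _ _ => sat_fPath _ _ _ _) fun _ X => ?_).2 (baire_pruned hT hpr hV fun n => ?_)
  · exact forall_congr' fun n => sat_fOpenMem _ _ _ _ _
  · exact (sat_fDense _ _ _ _ (F' := fun X => Path X T) (B' := OpenMem n V)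
      (fun _ _ => sat_fPath _ _ _ _) fun _ _ => sat_fOpenMem _ _ _ _ _).1 (hd n)

end

end RCAModel

/-- Completeness for `RCA₀`; an assignment provides the set that a model must have. -/
theorem provable_RCA0_of_sat {a : Fml}
    (h : ∀ (M : RCAModel) (e : ℕ → M.N) (E : ℕ → M.S), a.Sat M.toStructure₂ e E) :
    Provable RCA0 a :=
  provable_of_forall_sat substClosed_RCA0 fun A hA e E => h ⟨A, ⟨E 0⟩, hA⟩ e E

end SOA

theorem mainTheorem12 :
    SOA.Provable SOA.RCA0 SOA.BCTCII ∧ SOA.Provable SOA.RCA0 SOA.BCTCIII :=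
  ⟨SOA.provable_RCA0_of_sat fun _ e E => SOA.RCAModel.sat_BCTCII e E,
    SOA.provable_RCA0_of_sat fun _ e E => SOA.RCAModel.sat_BCTCIII e E⟩
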